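/- Let $n,r\ge 0$ be integers and let $A=(a_{ij})$ be a real $n\times r$ matrix with non-negative entries and with at least one positive entry in each row and in each column. The Shintani zeta function of $A$ is \[ \zeta_A(s)=\sum_{m_1\ge 1}\cdots\sum_{m_r\ge 1}\ \prod_{i=1}^{n}\,(a_{i1}m_1+\dots+a_{ir}m_r)^{-s_i},\qquad s=(s_1,\dots,s_n)\in\mathbb{C}^n . \] This series converges absolutely whenever $\Re(s_i)>r$ for every $1\le i\le n$, and $\zeta_A$, defined at the points of absolute convergence of the series, has a meromorphic extension to $\mathbb{C}^n$. For every non-empty $J\subseteq\{1,\dots,r\}$ let $\mu_J\in\{0,1\}^n$ be the vector whose support is the union of the supports of the columns of $A$ indexed by $J$, i.e. $(\mu_J)_i=1$ if $a_{ij}\neq 0$ for some $j\in J$, and $(\mu_J)_i=0$ otherwise; write $\langle\mu_J,s\rangle=\sum_{i=1}^n(\mu_J)_i s_i$. Then every singularity of the meromorphic extension of $\zeta_A$ (that is, every point of $\mathbb{C}^n$ near which the extension is not holomorphic) lies on one of the hyperplanes \[ \langle\mu_J,s\rangle=|J|-l,\qquad \emptyset\ne J\subseteq\{1,\dots,r\},\quad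 l\in\mathbb{Z}_{\ge 0}, \] where, whenever $\mu_J$ is a vector of the canonical basis of $\mathbb{R}^n$, only the values $l\in\{0,1,\dots,|J|-1\}$ are needed. -/

import Mathlib

open Filter Topology

noncomputable section

namespace Shintani

/-- The set `Σ_{n×r}(ℝ_{≥0})`: real `n × r` matrices with non-negative entries and with at least one
positive entry in each row and in each column. -/
def IsShintaniMatrix {n r : ℕ} (A : Matrix (Fin n) (Fin r) ℝ) : Prop :=
  (∀ i j, 0 ≤ A i j) ∧ (∀ i, ∃ j, 0 < A i j) ∧ (∀ j, ∃ i, 0 < A i j)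

/-- The summand with index `m = (m_1, …, m_r)`, `m_j ≥ 1`, of the Shintani zeta function:
`∏ i, (a_{i1} m_1 + ⋯ + a_{ir} m_r) ^ (-s_i)`. -/
def zetaTerm {n r : ℕ} (A : Matrix (Fin n) (Fin r) ℝ) (s : Fin n → ℂ) (m : Fin r → ℕ+) : ℂ :=
  ∏ i, ((∑ j, A i j * (m j : ℝ) : ℝ) : ℂ) ^ (-s i)

/-- The series defining `ζ_A` converges absolutely at `s`. -/
def AbsConvergesAt {n r : ℕ} (A : Matrix (Fin n) (Fin r) ℝ) (s : Fin n → ℂ) : Prop :=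
  Summable fun m : Fin r → ℕ+ => ‖zetaTerm A s m‖

/-- The Shintani zeta function `ζ_A(s)`, as the sum of its series (meaningful at points of absolute
convergence). -/
def zeta {n r : ℕ} (A : Matrix (Fin n) (Fin r) ℝ) (s : Fin n → ℂ) : ℂ :=
  ∑' m : Fin r → ℕ+, zetaTerm A s m

/-- `F` and `G` agree near `p` outside the zero set of some holomorphic function that does not
vanish identically near `p`. -/
def AgreeGenericallyAt {n : ℕ} (F G : (Fin n → ℂ) → ℂ) (p : Fin n → ℂ) : Prop :=
  ∃ h : (Fin n → ℂ) → ℂ, AnalyticAt ℂ h p ∧ (¬ ∀ᶠ z in 𝓝 p, h z = 0) ∧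
    ∀ᶠ z in 𝓝 p, h z ≠ 0 → F z = G z

/-- `F` is a meromorphic function on `ℂⁿ`: near every point `p` it is a quotient `g / h` of
holomorphic functions, `h` not identically zero near `p`. (The values of `F` on the zero set of `h`
are immaterial.) -/
def IsMeromorphic {n : ℕ} (F : (Fin n → ℂ) → ℂ) : Prop :=
  ∀ p : Fin n → ℂ, ∃ g h : (Fin n → ℂ) → ℂ, AnalyticAt ℂ g p ∧ AnalyticAt ℂ h p ∧
    (¬ ∀ᶠ z in 𝓝 p, h z = 0) ∧ ∀ᶠ z in 𝓝 p, h z ≠ 0 → F z = g z / h z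

/-- The set of singularities of a meromorphic function: the points near which it does not coincide,
as a meromorphic function, with a holomorphic function. -/
def singularLocus {n : ℕ} (F : (Fin n → ℂ) → ℂ) : Set (Fin n → ℂ) :=
  {p | ¬ ∃ G : (Fin n → ℂ) → ℂ, AnalyticAt ℂ G p ∧ AgreeGenericallyAt F G p}

/-- `F` is a meromorphic extension of `ζ_A` to `ℂⁿ`: it is meromorphic on `ℂⁿ` and equals the sum of
the series wherever the latter converges absolutely. -/
def IsMeromorphicExtension {n r : ℕ} (A : Matrix (Fin n) (Fin r) ℝ) (F : (Fin n → ℂ) → ℂ) : Prop :=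
  IsMeromorphic F ∧ ∀ s, AbsConvergesAt A s → F s = zeta A s

/-- The vector `μ_J ∈ {0,1}ⁿ` whose support is the union of the supports of the columns of `A`
indexed by `J`. -/
def mu {n r : ℕ} (A : Matrix (Fin n) (Fin r) ℝ) (J : Finset (Fin r)) : Fin n → ℕ :=
  Set.indicator (⋃ j ∈ J, Function.support fun i => A i j) fun _ => 1

/-- The hyperplane `⟨μ_J, s⟩ = |J| - l` of `ℂⁿ`. -/
def hyperplane {n r : ℕ} (A : Matrix (Fin n) (Fin r) ℝ) (J : Finset (Fin r)) (l : ℕ) :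
    Set (Fin n → ℂ) :=
  {s | ∑ i, (mu A J i : ℂ) * s i = (J.card : ℂ) - (l : ℂ)}

end Shintani

end

/-!
The continuation of `ζ_A` rests on a discrete form of Euler's identity for homogeneous functions.
For a summand `φ(x) = ∏ i, L_i(x) ^ (-z_i)`, with `L_i` the linear forms of `A`, and for a fixed
shift `b`, the discrete derivative of `m_j φ(m + b)` in the `j`-th direction sums to zero over
`m ∈ ℕ^r`, because this function vanishes for `m_j = 0`. Expanding it by Taylor's
formula and adding up the directions `j ∈ J`, the first order terms produce
`(⟨μ_J, z⟩ - |J|) ∑ φ`, because `∑_{j ∈ J} A i j * x_j` is `L_i(x)` minus the part of `L_i` outside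
`J`. All that remains has the same shape with better decay: a factor `x_j / L_i` with `j ∉ J`, a
factor `1 / L_i` with a row `i` meeting `J`, or a second derivative at a shifted lattice
(`ShiftFamily.recurrence`). Two devices keep this class of sums closed. Monomials in `m` are
represented by products of rising factorials, for which the discrete derivative has no error term
(`lowerWeight_add_single`), and the integral remainder of Taylor's formula is absorbed by averaging
over real shifts of the lattice (`ShiftFamily`). No remainder is ever estimated before the very end.

The bookkeeping quantity is the excess `D_J = ∑_{i ∈ rowsOf J} d_i - ∑_{j ∈ J} α_j` of a sum with
denominators `∏ L_i ^ d_i` and monomial weight of exponent `α`. No step of the recurrence lowers any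
`D_J`, and the step for `J` raises `D_J` at the price of the denominator
`⟨μ_J, s⟩ - |J| + D_J`. Once all `D_J` are large, Hall's marriage theorem matches the coordinates
with the linear forms and yields absolute convergence in a large region
(`prod_pow_le_prod_pow_of_hall`, `IsShintaniMatrix.exists_majorant`), and there the sum is analytic
as a Laplace-type integral (`analyticAt_integral_exp`). Induction on the missing excess gives
`hasContinuation`, with explicit denominators.

It is enough to run the recurrence for those `J` that contain every column supported in the rows of
`J`, and these are determined by their rows. If such a `J` meets a single row `i`, so that `μ_J` is
a vector of the canonical basis, the candidate poles at `s_i = -q` with `q ≥ 0` do not occur: every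
increase of the exponent `d_i` comes with the factor `s_i + d_i`, and these factors cancel the
denominators in question (`hyperplanePoly_mul_denom_dvd`).

The continuations to the regions `Re s_i > -N` are glued along quotients, and an identity principle
for meromorphic functions (`IsMeromorphic.generic_eq`) transfers the result to an arbitrary
meromorphic extension. Since an extension has to equal the sum of the series at all points of
absolute convergence, also at those outside the interior, radial limits are used at such points
(`AbsConvergesAt.mul_zeta_eq`).
-/

noncomputable section

namespace Shintani

open MeasureTheory

/-! ### Analyticity of Laplace-type integrals in several variables -/

section

/-- The complex linear form `s ↦ -∑ i, s i * v i` attached to a real vector `v`. -/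
def negPairing {n : ℕ} (v : Fin n → ℝ) : (Fin n → ℂ) →L[ℂ] ℂ :=
  -∑ i, ((v i : ℝ) : ℂ) • (ContinuousLinearMap.proj i : (Fin n → ℂ) →L[ℂ] ℂ)

lemma negPairing_apply {n : ℕ} (v : Fin n → ℝ) (s : Fin n → ℂ) :
    negPairing v s = -∑ i, s i * (v i : ℂ) := by
  simp [negPairing, mul_comm]

lemma continuous_negPairing {n : ℕ} :
    Continuous (negPairing : (Fin n → ℝ) → ((Fin n → ℂ) →L[ℂ] ℂ)) := by
  unfold negPairing
  fun_prop

lemma norm_negPairing_le {n : ℕ} (v : Fin n → ℝ) : ‖negPairing v‖ ≤ ∑ i, |v i| := by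
  refine ContinuousLinearMap.opNorm_le_bound _ (Finset.sum_nonneg fun i _ => abs_nonneg _) ?_
  intro s
  rw [negPairing_apply, norm_neg, Finset.sum_mul]
  refine (norm_sum_le _ _).trans (Finset.sum_le_sum fun i _ => ?_)
  rw [norm_mul, Complex.norm_real, Real.norm_eq_abs, mul_comm]
  exact mul_le_mul_of_nonneg_left (norm_le_pi_norm s i) (abs_nonneg _)

/-- The multilinear form `(y₁, …, y_k) ↦ f y₁ ⋯ f y_k`. -/
def linPow {n : ℕ} (k : ℕ) (f : (Fin n → ℂ) →L[ℂ] ℂ) :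
    ContinuousMultilinearMap ℂ (fun _ : Fin k => Fin n → ℂ) ℂ :=
  (ContinuousMultilinearMap.mkPiAlgebraFin ℂ k ℂ).compContinuousLinearMap fun _ => f

lemma linPow_apply {n : ℕ} (k : ℕ) (f : (Fin n → ℂ) →L[ℂ] ℂ) (y : Fin n → ℂ) :
    linPow k f (fun _ => y) = f y ^ k := by
  simp [linPow, List.ofFn_const]

lemma norm_linPow_le {n : ℕ} (k : ℕ) (f : (Fin n → ℂ) →L[ℂ] ℂ) : ‖linPow k f‖ ≤ ‖f‖ ^ k := by
  refine (ContinuousMultilinearMap.norm_compContinuousLinearMap_le _ _).trans ?_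
  simp

lemma continuous_linPow {n : ℕ} (k : ℕ) :
    Continuous (linPow k : ((Fin n → ℂ) →L[ℂ] ℂ) → _) := by
  have h := (ContinuousMultilinearMap.compContinuousLinearMapContinuousMultilinear ℂ
    (fun _ : Fin k => Fin n → ℂ) (fun _ : Fin k => ℂ) ℂ).cont
  have h2 : Continuous fun f : (Fin n → ℂ) →L[ℂ] ℂ =>
      (ContinuousMultilinearMap.compContinuousLinearMapContinuousMultilinear ℂ
    (fun _ : Fin k => Fin n → ℂ) (fun _ : Fin k => ℂ) ℂ) (fun _ => f)
      (ContinuousMultilinearMap.mkPiAlgebraFin ℂ k ℂ) :=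
    (h.comp (continuous_pi fun _ => continuous_id)).clm_apply continuous_const
  exact h2

/-- A Laplace-type integral `∫ w(θ) exp(-⟨s, ℓ(θ)⟩)` in several complex variables is analytic at `p`
as soon as it converges absolutely at a point whose coordinates all have slightly smaller real
parts, provided that `ℓ` is bounded below. The power series is obtained by expanding the
exponential under the integral sign. -/
theorem analyticAt_integral_exp {Θ : Type*} [MeasurableSpace Θ] {μ : Measure Θ} {n : ℕ}
    {w : Θ → ℂ} (hw : AEStronglyMeasurable w μ) {l : Θ → Fin n → ℝ} (hl : Measurable l)
    (p : Fin n → ℂ) (K ε : ℝ) (hε : 0 < ε) (hK : ∀ θ i, -K ≤ l θ i)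
    (hint : Integrable (fun θ => ‖w θ‖ * Real.exp (-∑ i, ((p i).re - ε) * l θ i)) μ) :
    AnalyticAt ℂ (fun s : Fin n → ℂ => ∫ θ, w θ * Complex.exp (-∑ i, s i * (l θ i : ℂ)) ∂μ) p := by
  -- The integrable majorant of all terms of the expansion.
  set g : Θ → ℝ := fun θ => ‖w θ‖ * Real.exp (-∑ i, (p i).re * l θ i) *
    Real.exp (ε * ∑ i, |l θ i|) with hg
  have hK0 : ∀ θ i, |l θ i| ≤ l θ i + 2 * |K| := by
    intro θ i
    have h1 := hK θ i
    have h2 := le_abs_self K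
    rcases abs_cases (l θ i) with h | h <;> linarith [abs_nonneg K]
  have hwm : AEStronglyMeasurable
      (fun θ => w θ * Complex.exp (-∑ i, p i * (l θ i : ℂ))) μ := by
    refine hw.mul (Measurable.aestronglyMeasurable ?_)
    have : ∀ i, Measurable fun θ => l θ i := fun i => (measurable_pi_apply i).comp hl
    fun_prop
  have hnorm : ∀ θ, ‖w θ * Complex.exp (-∑ i, p i * (l θ i : ℂ))‖ =
      ‖w θ‖ * Real.exp (-∑ i, (p i).re * l θ i) := by
    intro θ
    rw [norm_mul, Complex.norm_exp]
    simp
  have hgi : Integrable g μ := by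
    refine (hint.const_mul (Real.exp (ε * (n * (2 * |K|))))).mono' ?_ ?_
    · have : ∀ i, Measurable fun θ => l θ i := fun i => (measurable_pi_apply i).comp hl
      refine (hw.norm.mul ?_).mul ?_
      · exact Measurable.aestronglyMeasurable (by fun_prop)
      · exact Measurable.aestronglyMeasurable (by fun_prop)
    · refine ae_of_all _ fun θ => ?_
      rw [Real.norm_of_nonneg (by positivity)]
      rw [hg]
      simp only
      rw [mul_left_comm, mul_assoc, ← Real.exp_add, ← Real.exp_add]
      refine mul_le_mul_of_nonneg_left (Real.exp_le_exp.2 ?_) (norm_nonneg _)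
      have : ∑ i, |l θ i| ≤ ∑ i, (l θ i + 2 * |K|) := Finset.sum_le_sum fun i _ => hK0 θ i
      rw [Finset.sum_add_distrib] at this
      simp only [Finset.sum_const, Finset.card_univ, Fintype.card_fin, nsmul_eq_mul] at this
      have h2 : ∑ i, ((p i).re - ε) * l θ i = ∑ i, (p i).re * l θ i - ε * ∑ i, l θ i := by
        rw [Finset.mul_sum, ← Finset.sum_sub_distrib]
        exact Finset.sum_congr rfl fun i _ => by ring
      rw [h2]
      nlinarith
  let F : ℕ → Θ → FormalMultilinearSeries ℂ (Fin n → ℂ) ℂ := fun _ θ k =>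
    (w θ * Complex.exp (-∑ i, p i * (l θ i : ℂ)) * ((k.factorial : ℂ))⁻¹) •
      linPow k (negPairing (l θ))
  have hFn : ∀ k θ, ‖F k θ k‖ * ε ^ k ≤ g θ := by
    intro k θ
    have h1 : ‖linPow k (negPairing (l θ))‖ ≤ (∑ i, |l θ i|) ^ k :=
      (norm_linPow_le _ _).trans (pow_le_pow_left₀ (norm_nonneg _) (norm_negPairing_le _) _)
    have hS : 0 ≤ ∑ i, |l θ i| := Finset.sum_nonneg fun i _ => abs_nonneg _
    have h2 : (ε * ∑ i, |l θ i|) ^ k / k.factorial ≤ Real.exp (ε * ∑ i, |l θ i|) :=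
      Real.pow_div_factorial_le_exp _ (by positivity) k
    simp only [F]
    rw [norm_smul, norm_mul, hnorm, norm_inv, Complex.norm_natCast]
    calc ‖w θ‖ * Real.exp (-∑ i, (p i).re * l θ i) * (k.factorial : ℝ)⁻¹ *
          ‖linPow k (negPairing (l θ))‖ * ε ^ k
        ≤ ‖w θ‖ * Real.exp (-∑ i, (p i).re * l θ i) * (k.factorial : ℝ)⁻¹ *
          (∑ i, |l θ i|) ^ k * ε ^ k := by gcongr
      _ = ‖w θ‖ * Real.exp (-∑ i, (p i).re * l θ i) *
          ((ε * ∑ i, |l θ i|) ^ k / k.factorial) := by rw [mul_pow]; ring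
      _ ≤ g θ := mul_le_mul_of_nonneg_left h2 (by positivity)
  have hFm : ∀ k, AEStronglyMeasurable (fun θ => F k θ k) μ := by
    intro k
    refine (hwm.mul aestronglyMeasurable_const).smul ?_
    exact ((continuous_linPow k).comp continuous_negPairing).comp_aestronglyMeasurable
      hl.aestronglyMeasurable
  have hFi : ∀ k, Integrable (fun θ => F k θ k) μ := by
    intro k
    refine (hgi.const_mul ((ε ^ k)⁻¹)).mono' (hFm k) (ae_of_all _ fun θ => ?_)
    rw [← div_eq_inv_mul, le_div_iff₀ (by positivity)]
    exact hFn k θ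
  let P : FormalMultilinearSeries ℂ (Fin n → ℂ) ℂ := fun k => ∫ θ, F k θ k ∂μ
  have hP : HasFPowerSeriesOnBall
      (fun s : Fin n → ℂ => ∫ θ, w θ * Complex.exp (-∑ i, s i * (l θ i : ℂ)) ∂μ) P p
      (ENNReal.ofReal ε) := by
    refine ⟨?_, ENNReal.ofReal_pos.2 hε, ?_⟩
    · refine P.le_radius_of_bound (∫ θ, g θ ∂μ) fun k => ?_
      rw [Real.coe_toNNReal _ hε.le]
      calc ‖P k‖ * ε ^ k ≤ (∫ θ, ‖F k θ k‖ ∂μ) * ε ^ k := by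
            gcongr; exact norm_integral_le_integral_norm _
        _ = ∫ θ, ‖F k θ k‖ * ε ^ k ∂μ := by rw [integral_mul_const]
        _ ≤ ∫ θ, g θ ∂μ := integral_mono ((hFi k).norm.mul_const _) hgi (hFn k)
    · intro y hy
      have hy : ‖y‖ < ε := by
        rw [← ENNReal.toReal_ofReal hε.le]
        simpa [Metric.mem_eball, edist_zero_right, ENNReal.lt_ofReal_iff_toReal_lt,
          ENNReal.toReal_ofReal hε.le] using hy
      have h0 : ∀ k, P k (fun _ => y) = ∫ θ, F k θ k (fun _ => y) ∂μ := fun k =>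
        ContinuousMultilinearMap.integral_apply (hFi k) _
      simp only [h0]
      have hFy : ∀ k θ, F k θ k (fun _ => y) = w θ * Complex.exp (-∑ i, p i * (l θ i : ℂ)) *
          ((negPairing (l θ) y) ^ k / (k.factorial : ℂ)) := by
        intro k θ
        simp only [F, smul_apply, linPow_apply, smul_eq_mul]
        ring
      have hbd : ∀ k θ, ‖F k θ k (fun _ => y)‖ ≤ ‖w θ‖ * Real.exp (-∑ i, (p i).re * l θ i) *
          ((ε * ∑ i, |l θ i|) ^ k / (k.factorial : ℝ)) := by
        intro k θ
        rw [hFy, norm_mul, hnorm, norm_div, norm_pow, Complex.norm_natCast]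
        gcongr
        calc ‖negPairing (l θ) y‖ ≤ ‖negPairing (l θ)‖ * ‖y‖ := (negPairing (l θ)).le_opNorm y
          _ ≤ (∑ i, |l θ i|) * ε := by
            refine mul_le_mul (norm_negPairing_le _) hy.le (norm_nonneg _)
              (Finset.sum_nonneg fun i _ => abs_nonneg _)
          _ = _ := mul_comm _ _
      have hsum : ∀ θ, HasSum (fun k : ℕ => ‖w θ‖ * Real.exp (-∑ i, (p i).re * l θ i) *
          ((ε * ∑ i, |l θ i|) ^ k / (k.factorial : ℝ))) (g θ) := by
        intro θ
        refine HasSum.mul_left _ ?_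
        rw [Real.exp_eq_exp_ℝ]
        exact NormedSpace.expSeries_div_hasSum_exp (ε * ∑ i, |l θ i|)
      refine hasSum_integral_of_dominated_convergence
        (fun k θ => ‖w θ‖ * Real.exp (-∑ i, (p i).re * l θ i) *
          ((ε * ∑ i, |l θ i|) ^ k / (k.factorial : ℝ))) ?_ ?_ ?_ ?_ ?_
      · intro k
        exact ((ContinuousMultilinearMap.apply ℂ (fun _ : Fin k => Fin n → ℂ) ℂ
          fun _ => y).continuous.comp_aestronglyMeasurable (hFm k))
      · exact fun k => ae_of_all _ (hbd k)
      · exact ae_of_all _ fun θ => (hsum θ).summable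
      · simp only [fun θ => (hsum θ).tsum_eq]
        exact hgi
      · refine ae_of_all _ fun θ => ?_
        simp only [hFy]
        have : w θ * Complex.exp (-∑ i, (p + y) i * (l θ i : ℂ)) =
            w θ * Complex.exp (-∑ i, p i * (l θ i : ℂ)) * Complex.exp (negPairing (l θ) y) := by
          rw [mul_assoc, ← Complex.exp_add, negPairing_apply]
          congr 2
          rw [← neg_add, ← Finset.sum_add_distrib]
          congr 1
          exact Finset.sum_congr rfl fun i _ => by simp [add_mul]
        rw [this]
        refine HasSum.mul_left _ ?_
        rw [Complex.exp_eq_exp_ℂ]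
        exact NormedSpace.expSeries_div_hasSum_exp (negPairing (l θ) y)
  exact hP.analyticAt

end

/-! ### Germs of analytic functions and the identity principle for meromorphic functions -/

section

/-- A function analytic at `p` whose germ at `p` is non-zero has non-zero germs near `p`. -/
lemma eventually_analyticAt_and_germ_ne_zero {n : ℕ} {h : (Fin n → ℂ) → ℂ} {p : Fin n → ℂ}
    (hh : AnalyticAt ℂ h p) (h0 : ¬ ∀ᶠ z in 𝓝 p, h z = 0) :
    ∀ᶠ q in 𝓝 p, AnalyticAt ℂ h q ∧ ¬ ∀ᶠ z in 𝓝 q, h z = 0 := by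
  obtain ⟨δ, hδ, hball⟩ := Metric.eventually_nhds_iff_ball.1 hh.eventually_analyticAt
  refine Metric.eventually_nhds_iff_ball.2 ⟨δ, hδ, fun q hq => ⟨hball q hq, fun hq0 => h0 ?_⟩⟩
  have han : AnalyticOnNhd ℂ h (Metric.ball p δ) := hball
  have := han.eqOn_zero_of_preconnected_of_eventuallyEq_zero (convex_ball p δ).isPreconnected hq hq0
  exact Metric.eventually_nhds_iff_ball.2 ⟨δ, hδ, fun z hz => this hz⟩

/-- The ring of germs of analytic functions at a point of `ℂⁿ` is a domain. -/
lemma germ_mul_ne_zero {n : ℕ} {f g : (Fin n → ℂ) → ℂ} {p : Fin n → ℂ}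
    (hf : AnalyticAt ℂ f p) (hg : AnalyticAt ℂ g p) (hf0 : ¬ ∀ᶠ z in 𝓝 p, f z = 0)
    (hg0 : ¬ ∀ᶠ z in 𝓝 p, g z = 0) : ¬ ∀ᶠ z in 𝓝 p, f z * g z = 0 := by
  intro h
  obtain ⟨δ, hδ, hball⟩ := Metric.eventually_nhds_iff_ball.1
    ((eventually_analyticAt_and_germ_ne_zero hg hg0).and
      (hf.eventually_analyticAt.and h.eventually_nhds))
  have hne : ∃ z ∈ Metric.ball p δ, f z ≠ 0 := by
    by_contra! hcon
    exact hf0 (Metric.eventually_nhds_iff_ball.2 ⟨δ, hδ, hcon⟩)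
  obtain ⟨z, hz, hfz⟩ := hne
  obtain ⟨⟨-, hgz⟩, hfa, hz0⟩ := hball z hz
  refine hgz ?_
  filter_upwards [hz0, hfa.continuousAt.eventually_ne hfz] with y hy hy'
  exact (mul_eq_zero.1 hy).resolve_left hy'

/-- Identity principle for meromorphic functions in several variables: an identity `Q F = E`, with
`Q` and `E` analytic, propagates generically from one point to a whole connected open set. -/
theorem IsMeromorphic.generic_eq {n : ℕ} {F : (Fin n → ℂ) → ℂ} (hF : IsMeromorphic F)
    {Ω : Set (Fin n → ℂ)} (hΩ : IsOpen Ω) (hΩc : IsPreconnected Ω) {Q E : (Fin n → ℂ) → ℂ}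
    (hQ : AnalyticOnNhd ℂ Q Ω) (hE : AnalyticOnNhd ℂ E Ω) {p₀ : Fin n → ℂ} (hp₀ : p₀ ∈ Ω)
    (h₀ : ∀ᶠ z in 𝓝 p₀, Q z * F z = E z) {p : Fin n → ℂ} (hp : p ∈ Ω) :
    ∃ h : (Fin n → ℂ) → ℂ, AnalyticAt ℂ h p ∧ (¬ ∀ᶠ z in 𝓝 p, h z = 0) ∧
      ∀ᶠ z in 𝓝 p, h z ≠ 0 → Q z * F z = E z := by
  set T : Set (Fin n → ℂ) := {p | ∃ h : (Fin n → ℂ) → ℂ, AnalyticAt ℂ h p ∧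
    (¬ ∀ᶠ z in 𝓝 p, h z = 0) ∧ ∀ᶠ z in 𝓝 p, h z ≠ 0 → Q z * F z = E z} with hT
  have hTo : IsOpen T := by
    rw [isOpen_iff_mem_nhds]
    rintro q ⟨h, hha, hh0, hh⟩
    filter_upwards [eventually_analyticAt_and_germ_ne_zero hha hh0, hh.eventually_nhds]
      with y hy hy'
    exact ⟨h, hy.1, hy.2, hy'⟩
  refine hΩc.subset_of_closure_inter_subset hTo ⟨p₀, hp₀, ⟨fun _ => 1, analyticAt_const, ?_,
    h₀.mono fun z hz _ => hz⟩⟩ ?_ hp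
  · intro hcon
    simpa using hcon.self_of_nhds
  · rintro q ⟨hq, hqΩ⟩
    obtain ⟨g, h, hga, hha, hh0, hgh⟩ := hF q
    obtain ⟨δ, hδ, hball⟩ := Metric.eventually_nhds_iff_ball.1
      ((hΩ.eventually_mem hqΩ).and (hga.eventually_analyticAt.and
        ((eventually_analyticAt_and_germ_ne_zero hha hh0).and hgh.eventually_nhds)))
    obtain ⟨y, hyb, k, hka, hk0, hk⟩ := Metric.mem_closure_iff.1 hq δ hδ |>.imp
      fun y hy => (⟨by rw [Metric.mem_ball, dist_comm]; exact hy.2, hy.1⟩ :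
        y ∈ Metric.ball q δ ∧ y ∈ T)
    obtain ⟨hyΩ, hgy, ⟨hhy, hhy0⟩, hghy⟩ := hball y hyb
    have hD : AnalyticOnNhd ℂ (fun z => Q z * g z - E z * h z) (Metric.ball q δ) := fun z hz =>
      ((hQ z (hball z hz).1).mul (hball z hz).2.1).sub
        ((hE z (hball z hz).1).mul (hball z hz).2.2.1.1)
    have hDy : ∀ᶠ z in 𝓝 y, Q z * g z - E z * h z = 0 := by
      by_contra hcon
      refine germ_mul_ne_zero (hhy.mul hka) (hD y hyb) (germ_mul_ne_zero hhy hka hhy0 hk0) hcon ?_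
      filter_upwards [hghy, hk] with z h1 h2
      by_cases hz : h z = 0
      · simp [hz]
      by_cases kz : k z = 0
      · simp [kz]
      rw [← h2 kz, h1 hz]
      field_simp
      simp
    have := hD.eqOn_zero_of_preconnected_of_eventuallyEq_zero
      (convex_ball q δ).isPreconnected hyb hDy
    refine ⟨h, hha, hh0, ?_⟩
    filter_upwards [Metric.ball_mem_nhds q hδ, hgh] with z hz h1 h2
    have h3 : Q z * g z - E z * h z = 0 := this hz
    rw [h1 h2, ← mul_div_assoc, div_eq_iff h2]
    linear_combination h3

end

/-! ### A Hall-type inequality between monomials -/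

/-- Hall's marriage theorem as an inequality between monomials: if every set of columns `J`,
counted with multiplicities `β`, is at most as large as the set of rows related to it, counted with
multiplicities `d`, then the monomial with exponents `β` is dominated by the one with exponents
`d`. -/
lemma prod_pow_le_prod_pow_of_hall {ι κ : Type*} [Fintype ι] [Fintype κ] (R : κ → ι → Prop)
    [∀ j, DecidablePred (R j)] (β : κ → ℕ) (d : ι → ℕ)
    (hall : ∀ J : Finset κ, ∑ j ∈ J, β j ≤ ∑ i with ∃ j ∈ J, R j i, d i)
    (y : κ → ℝ) (u : ι → ℝ) (hy : ∀ j, 0 ≤ y j) (hu : ∀ i, d i ≠ 0 → 1 ≤ u i)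
    (hR : ∀ j i, R j i → y j ≤ u i) : ∏ j, y j ^ β j ≤ ∏ i, u i ^ d i := by
  classical
  let t : (Σ j : κ, Fin (β j)) → Finset (Σ i : ι, Fin (d i)) := fun a =>
    (Finset.univ.filter (R a.1)).sigma fun _ => Finset.univ
  have hH : ∃ f : (Σ j : κ, Fin (β j)) → (Σ i : ι, Fin (d i)),
      Function.Injective f ∧ ∀ x, f x ∈ t x := by
    rw [← Finset.all_card_le_biUnion_card_iff_exists_injective]
    intro S
    have h1 : S ⊆ (S.image Sigma.fst).sigma fun _ => Finset.univ := by
      intro a ha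
      simp only [Finset.mem_sigma, Finset.mem_univ, and_true]
      exact Finset.mem_image_of_mem _ ha
    have h2 : S.biUnion t = (Finset.univ.filter fun i => ∃ j ∈ S.image Sigma.fst, R j i).sigma
        fun _ => Finset.univ := by
      ext ⟨i, k⟩
      simp only [t, Finset.mem_biUnion, Finset.mem_sigma, Finset.mem_filter, Finset.mem_univ,
        true_and, and_true, Finset.mem_image]
      constructor
      · rintro ⟨a, ha, hai⟩
        exact ⟨a.1, ⟨a, ha, rfl⟩, hai⟩
      · rintro ⟨j, ⟨a, ha, rfl⟩, hai⟩
        exact ⟨a, ha, hai⟩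
    calc S.card ≤ _ := Finset.card_le_card h1
      _ = ∑ j ∈ S.image Sigma.fst, β j := by simp [Finset.card_sigma]
      _ ≤ _ := hall _
      _ = (S.biUnion t).card := by rw [h2]; simp [Finset.card_sigma]
  obtain ⟨f, hf, hft⟩ := hH
  have hpos : ∀ b : (Σ i : ι, Fin (d i)), 1 ≤ u b.1 := fun b =>
    hu b.1 (by have := b.2.2; omega)
  calc ∏ j, y j ^ β j = ∏ a : (Σ j : κ, Fin (β j)), y a.1 := by
        rw [Fintype.prod_sigma]; simp
    _ ≤ ∏ a : (Σ j : κ, Fin (β j)), u (f a).1 := by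
        refine Finset.prod_le_prod (fun a _ => hy _) fun a _ => hR _ _ ?_
        have := hft a
        simp only [t, Finset.mem_sigma, Finset.mem_filter, Finset.mem_univ, true_and,
          and_true] at this
        exact this
    _ = ∏ b ∈ Finset.univ.image f, u b.1 := by
        rw [Finset.prod_image fun a _ b _ h => hf h]
    _ ≤ ∏ b : (Σ i : ι, Fin (d i)), u b.1 := by
        refine Finset.prod_le_prod_of_subset_of_one_le (Finset.subset_univ _)
          (fun b _ => zero_le_one.trans (hpos b)) fun b _ _ => hpos b
    _ = ∏ i, u i ^ d i := by rw [Fintype.prod_sigma]; simp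

/-- `∏ j, (m_j + 1)^{-p}` is summable over `m ∈ ℕ^r` when `p > 1`. -/
lemma summable_prod_rpow (r : ℕ) {p : ℝ} (hp : 1 < p) :
    Summable fun m : Fin r → ℕ => ∏ j, ((m j : ℝ) + 1) ^ (-p) := by
  have h1 : Summable fun k : ℕ => ((k : ℝ) + 1) ^ (-p) := by
    have := (summable_nat_add_iff 1).2 (Real.summable_nat_rpow.2 (neg_lt_neg hp))
    simpa using this
  induction r with
  | zero => exact Summable.of_finite
  | succ r ih =>
    let e : ℕ × (Fin r → ℕ) ≃ (Fin (r + 1) → ℕ) := Fin.consEquiv fun _ : Fin (r + 1) => ℕ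
    have he : ∀ x, (∏ j, ((e x j : ℝ) + 1) ^ (-p)) =
        ((x.1 : ℝ) + 1) ^ (-p) * ∏ j, ((x.2 j : ℝ) + 1) ^ (-p) := by
      intro x
      rw [Fin.prod_univ_succ]
      rfl
    refine e.summable_iff.1 ((h1.mul_of_nonneg ih (fun k => ?_) fun m => ?_).congr fun x => ?_)
    · positivity
    · exact Finset.prod_nonneg fun j _ => by positivity
    · exact (he x).symm

/-! ### Linear forms, kernels and summable majorants -/

section

/-- The value at `x` of the linear form given by the `i`-th row of `A`. -/
def linForm {n r : ℕ} (A : Matrix (Fin n) (Fin r) ℝ) (x : Fin r → ℝ) (i : Fin n) : ℝ :=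
  ∑ j, A i j * x j

/-- The function `∏ i, L_i(x) ^ (-z_i)`, where `L_i` are the linear forms of `A`, written with real
logarithms. It has this meaning where all `L_i(x)` are positive. -/
def kernel {n r : ℕ} (A : Matrix (Fin n) (Fin r) ℝ) (z : Fin n → ℂ) (x : Fin r → ℝ) : ℂ :=
  Complex.exp (-∑ i, z i * (Real.log (linForm A x i) : ℂ))

open Classical in
/-- The rows of `A` with a non-zero entry in one of the columns of `J`. -/
def rowsOf {n r : ℕ} (A : Matrix (Fin n) (Fin r) ℝ) (J : Finset (Fin r)) : Finset (Fin n) :=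
  {i | ∃ j ∈ J, A i j ≠ 0}

lemma mem_rowsOf {n r : ℕ} {A : Matrix (Fin n) (Fin r) ℝ} {J : Finset (Fin r)} {i : Fin n} :
    i ∈ rowsOf A J ↔ ∃ j ∈ J, A i j ≠ 0 := by
  simp [rowsOf]

/-- The polynomial weight `∏ j, (m_j + 1) (m_j + 2) ⋯ (m_j + α_j)`. -/
def weight {r : ℕ} (α : Fin r → ℕ) (m : Fin r → ℕ) : ℝ :=
  ∏ j, (((m j + 1).ascFactorial (α j) : ℕ) : ℝ)

lemma weight_nonneg {r : ℕ} (α : Fin r → ℕ) (m : Fin r → ℕ) : 0 ≤ weight α m :=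
  Finset.prod_nonneg fun _ _ => Nat.cast_nonneg _

lemma IsShintaniMatrix.exists_pos_le {n r : ℕ} {A : Matrix (Fin n) (Fin r) ℝ}
    (hA : IsShintaniMatrix A) : ∃ a : ℝ, 0 < a ∧ ∀ i j, A i j ≠ 0 → a ≤ A i j := by
  classical
  let S : Finset ℝ :=
    insert 1 ((Finset.univ.image fun q : Fin n × Fin r => A q.1 q.2).filter (0 < ·))
  have hS : S.Nonempty := ⟨1, Finset.mem_insert_self _ _⟩
  refine ⟨S.min' hS, ?_, fun i j hij => Finset.min'_le _ _ ?_⟩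
  · rw [Finset.lt_min'_iff]
    intro y hy
    rcases Finset.mem_insert.1 hy with rfl | hy
    · exact one_pos
    · exact (Finset.mem_filter.1 hy).2
  · exact Finset.mem_insert_of_mem (Finset.mem_filter.2
      ⟨Finset.mem_image.2 ⟨(i, j), Finset.mem_univ _, rfl⟩, lt_of_le_of_ne (hA.1 i j) (Ne.symm hij)⟩)

section Bounds

variable {n r : ℕ} {A : Matrix (Fin n) (Fin r) ℝ}

lemma IsShintaniMatrix.le_linForm (hA : IsShintaniMatrix A) {a : ℝ}
    (haA : ∀ i j, A i j ≠ 0 → a ≤ A i j) {x y : Fin r → ℝ} (hy : ∀ j, 1 ≤ y j)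
    (hyx : ∀ j, y j ≤ x j) {i : Fin n} {j : Fin r} (hij : A i j ≠ 0) :
    a * y j ≤ linForm A x i := by
  have h1 : A i j * x j ≤ linForm A x i :=
    Finset.single_le_sum (f := fun j => A i j * x j)
      (fun k _ => mul_nonneg (hA.1 i k) (by linarith [hy k, hyx k])) (Finset.mem_univ j)
  exact (mul_le_mul (haA i j hij) (hyx j) (by linarith [hy j]) (hA.1 i j)).trans h1

lemma IsShintaniMatrix.const_le_linForm (hA : IsShintaniMatrix A) {a : ℝ}
    (haA : ∀ i j, A i j ≠ 0 → a ≤ A i j) {x : Fin r → ℝ} (hx : ∀ j, 1 ≤ x j) (i : Fin n) :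
    a ≤ linForm A x i := by
  obtain ⟨j, hj⟩ := hA.2.1 i
  simpa using hA.le_linForm haA (y := fun _ => 1) (fun _ => le_rfl) hx hj.ne'

lemma IsShintaniMatrix.linForm_pos (hA : IsShintaniMatrix A) {x : Fin r → ℝ}
    (hx : ∀ j, 1 ≤ x j) (i : Fin n) : 0 < linForm A x i := by
  obtain ⟨a, ha, haA⟩ := hA.exists_pos_le
  exact ha.trans_le (hA.const_le_linForm haA hx i)

lemma IsShintaniMatrix.linForm_le (hA : IsShintaniMatrix A) {x y : Fin r → ℝ} {B : ℝ}
    (hB : 1 ≤ B) (hy : ∀ j, 1 ≤ y j) (hxy : ∀ j, x j ≤ B * y j) (i : Fin n) :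
    linForm A x i ≤ (B * (1 + ∑ i, ∑ j, A i j)) * ∏ j, y j := by
  have hP : 1 ≤ ∏ j, y j := Finset.one_le_prod fun k _ => hy k
  have h1 : ∀ j, y j ≤ ∏ j, y j := fun j => by
    rw [← Finset.mul_prod_erase Finset.univ y (Finset.mem_univ j)]
    exact le_mul_of_one_le_right (by linarith [hy j]) (Finset.one_le_prod fun k _ => hy k)
  calc linForm A x i ≤ ∑ j, A i j * (B * ∏ j, y j) := by
        refine Finset.sum_le_sum fun j _ => mul_le_mul_of_nonneg_left ?_ (hA.1 i j)
        exact (hxy j).trans (mul_le_mul_of_nonneg_left (h1 j) (by linarith))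
    _ = (∑ j, A i j) * (B * ∏ j, y j) := by rw [Finset.sum_mul]
    _ ≤ (1 + ∑ i, ∑ j, A i j) * (B * ∏ j, y j) := by
        refine mul_le_mul_of_nonneg_right ?_ (by positivity)
        have := Finset.single_le_sum (f := fun i => ∑ j, A i j)
          (fun k _ => Finset.sum_nonneg fun j _ => hA.1 k j) (Finset.mem_univ i)
        linarith [this]
    _ = _ := by ring

/-- Logarithmic form of the Hall-type inequality between a monomial in the coordinates and a
monomial in the linear forms of `A`. -/
lemma IsShintaniMatrix.hall_log (hA : IsShintaniMatrix A) {a : ℝ} (ha : 0 < a)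
    (haA : ∀ i j, A i j ≠ 0 → a ≤ A i j) {x y : Fin r → ℝ} (hy : ∀ j, 1 ≤ y j)
    (hyx : ∀ j, y j ≤ x j) {β : Fin r → ℕ} {d : Fin n → ℕ}
    (hall : ∀ J : Finset (Fin r), ∑ j ∈ J, β j ≤ ∑ i ∈ rowsOf A J, d i) :
    ∑ j, (β j : ℝ) * Real.log (y j) ≤
      ∑ i, (d i : ℝ) * (Real.log (linForm A x i) - Real.log a) := by
  classical
  have hx : ∀ j, 1 ≤ x j := fun j => (hy j).trans (hyx j)
  have hL : ∀ i, 0 < linForm A x i := hA.linForm_pos hx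
  have h := prod_pow_le_prod_pow_of_hall (fun j i => A i j ≠ 0) β d
    (fun J => (hall J).trans_eq (Finset.sum_congr (by ext; simp [mem_rowsOf]) fun _ _ => rfl)) y
    (fun i => linForm A x i / a) (fun j => by linarith [hy j])
    (fun i _ => by rw [le_div_iff₀ ha, one_mul]; exact hA.const_le_linForm haA hx i)
    (fun j i hij => by
      rw [le_div_iff₀ ha, mul_comm]; exact hA.le_linForm haA hy hyx hij)
  have hy0 : ∀ j, y j ≠ 0 := fun j => by linarith [hy j]
  have h2 := Real.log_le_log (Finset.prod_pos fun j _ => pow_pos (by linarith [hy j]) _) h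
  rw [Real.log_prod fun j _ => pow_ne_zero _ (hy0 j),
    Real.log_prod fun i _ => pow_ne_zero _ (div_pos (hL i) ha).ne'] at h2
  simpa only [Real.log_pow, Real.log_div (hL _).ne' ha.ne'] using h2

lemma weight_le {α : Fin r → ℕ} :
    ∃ c : ℝ, ∀ m : Fin r → ℕ, weight α m ≤
      Real.exp (c + ∑ j, (α j : ℝ) * Real.log ((m j : ℝ) + 1)) := by
  refine ⟨∑ j, (α j : ℝ) * Real.log ((α j : ℝ) + 1), fun m => ?_⟩
  rw [← Finset.sum_add_distrib, Real.exp_sum]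
  refine Finset.prod_le_prod (fun _ _ => Nat.cast_nonneg _) fun j _ => ?_
  have h1 : ((m j + 1).ascFactorial (α j) : ℝ) ≤ (((α j : ℝ) + 1) * ((m j : ℝ) + 1)) ^ α j := by
    have : (m j + 1).ascFactorial (α j) ≤ (m j + α j) ^ α j := Nat.ascFactorial_le_pow_add _ _
    refine (Nat.cast_le.2 this).trans ?_
    push_cast
    gcongr
    nlinarith [mul_nonneg (Nat.cast_nonneg (α := ℝ) (α j)) (Nat.cast_nonneg (α := ℝ) (m j))]
  refine h1.trans (le_of_eq ?_)
  rw [← mul_add, ← Real.log_mul (by positivity) (by positivity), Real.exp_nat_mul,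
    Real.exp_log (by positivity)]

/-- In both regimes needed below, the summand of a weighted Shintani sum has an absolutely summable
majorant, uniformly in the bounded shift `x - m`: either the combinatorial excess is non-negative
and all real parts exceed `r`, or the real parts exceed `-N` and the excess is large. -/
lemma IsShintaniMatrix.exists_majorant (hA : IsShintaniMatrix A) {B : ℝ} (hB : 1 ≤ B)
    {d : Fin n → ℕ} {α : Fin r → ℕ} {κ N : ℕ} {σ : Fin n → ℝ}
    (hD : ∀ J : Finset (Fin r), κ * J.card + ∑ j ∈ J, α j ≤ ∑ i ∈ rowsOf A J, d i)
    (hσ : (∀ i, (r : ℝ) < σ i) ∨ (n * N + 2 ≤ κ ∧ ∀ i, -(N : ℝ) < σ i)) :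
    ∃ C p : ℝ, 1 < p ∧ ∀ (m : Fin r → ℕ) (x : Fin r → ℝ), (∀ j, (m j : ℝ) + 1 ≤ x j) →
      (∀ j, x j ≤ B * ((m j : ℝ) + 1)) →
      weight α m * Real.exp (-∑ i, (σ i + d i) * Real.log (linForm A x i)) ≤
        C * ∏ j, ((m j : ℝ) + 1) ^ (-p) := by
  obtain ⟨a, ha, haA⟩ := hA.exists_pos_le
  obtain ⟨c, hc⟩ := weight_le (α := α)
  have hone : ∀ (m : Fin r → ℕ) j, (1 : ℝ) ≤ (m j : ℝ) + 1 := fun m j => by simp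
  -- The part of the exponent carried by `σ`.
  have key : ∃ c' p : ℝ, 1 < p ∧ ∀ (m : Fin r → ℕ) (x : Fin r → ℝ), (∀ j, (m j : ℝ) + 1 ≤ x j) →
      (∀ j, x j ≤ B * ((m j : ℝ) + 1)) →
      -∑ i, σ i * Real.log (linForm A x i) ≤
        c' - (p - κ) * ∑ j, Real.log ((m j : ℝ) + 1) := by
    rcases hσ with hσ | ⟨hκ, hσ⟩
    -- Hall's condition holds with multiplicity one on columns and `r` on rows; the resulting
    -- inequality is raised to a power `q > 1` with `r * q ≤ σ i`.
    · obtain ⟨q, hq1, hq⟩ : ∃ q : ℝ, 1 < q ∧ ∀ i, r * q ≤ σ i := by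
        have : ∀ i, ∀ᶠ q in 𝓝[>] (1 : ℝ), r * q ≤ σ i := fun i => by
          have hc : Tendsto (fun q : ℝ => r * q) (𝓝[>] 1) (𝓝 (r * 1)) :=
            (Continuous.tendsto (by fun_prop) 1).mono_left nhdsWithin_le_nhds
          rw [mul_one] at hc
          exact (hc.eventually_lt_const (hσ i)).mono fun _ h => h.le
        obtain ⟨q, hq, hq'⟩ := ((eventually_all.2 this).and self_mem_nhdsWithin).exists
        exact ⟨q, hq', hq⟩
      refine ⟨-∑ i, σ i * Real.log a, q + κ, by linarith [Nat.cast_nonneg (α := ℝ) κ],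
        fun m x h1 h2 => ?_⟩
      have hr : ∀ J : Finset (Fin r), ∑ _j ∈ J, 1 ≤ ∑ _i ∈ rowsOf A J, r := by
        intro J
        rcases J.eq_empty_or_nonempty with rfl | ⟨j, hj⟩
        · simp
        · obtain ⟨i, hi⟩ := hA.2.2 j
          have hne : 1 ≤ (rowsOf A J).card :=
            Finset.card_pos.2 ⟨i, mem_rowsOf.2 ⟨j, hj, hi.ne'⟩⟩
          have hJ : J.card ≤ r := by simpa using Finset.card_le_univ J
          simp only [Finset.sum_const, smul_eq_mul, mul_one]
          exact hJ.trans (Nat.le_mul_of_pos_left r hne)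
      have h3 := hA.hall_log ha haA (hone m) h1 hr
      have h4 : ∀ i, r * q * (Real.log (linForm A x i) - Real.log a) ≤
          σ i * (Real.log (linForm A x i) - Real.log a) := fun i =>
        mul_le_mul_of_nonneg_right (hq i) (sub_nonneg.2 (Real.log_le_log ha
          (hA.const_le_linForm haA (fun j => (hone m j).trans (h1 j)) i)))
      have h5 := Finset.sum_le_sum fun i (_ : i ∈ Finset.univ) => h4 i
      have h6 : ∑ i, r * q * (Real.log (linForm A x i) - Real.log a) =
          q * ∑ i, (r : ℝ) * (Real.log (linForm A x i) - Real.log a) := by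
        rw [Finset.mul_sum]
        exact Finset.sum_congr rfl fun i _ => by ring
      have h7 := mul_le_mul_of_nonneg_left h3 (by linarith : (0 : ℝ) ≤ q)
      simp only [Nat.cast_one, one_mul] at h7
      rw [← h6] at h7
      simp only [mul_sub, Finset.sum_sub_distrib] at h5 h7 ⊢
      rw [add_sub_cancel_right]
      linarith
    -- Every `L_i` is at most a constant times `∏ j, (m_j + 1)`, so that `∏ i, L_i ^ N` costs the
    -- exponent `n * N`, which `κ` makes up for.
    · refine ⟨-(∑ i, σ i * Real.log a) +
          n * N * (Real.log (B * (1 + ∑ i, ∑ j, A i j)) - Real.log a), κ - n * N, ?_, fun m x h1 h2 => ?_⟩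
      · have : ((n * N + 2 : ℕ) : ℝ) ≤ κ := Nat.cast_le.2 hκ
        push_cast at this
        linarith
      have hS : 0 < B * (1 + ∑ i, ∑ j, A i j) := by
        have : 0 ≤ ∑ i, ∑ j, A i j :=
          Finset.sum_nonneg fun i _ => Finset.sum_nonneg fun j _ => hA.1 i j
        positivity
      have hx : ∀ j, 1 ≤ x j := fun j => (hone m j).trans (h1 j)
      have h3 : ∀ i, -(σ i * (Real.log (linForm A x i) - Real.log a)) ≤
          N * (Real.log (B * (1 + ∑ i, ∑ j, A i j)) + ∑ j, Real.log ((m j : ℝ) + 1) -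
            Real.log a) := by
        intro i
        have h4 : 0 ≤ Real.log (linForm A x i) - Real.log a := sub_nonneg.2
          (Real.log_le_log ha (hA.const_le_linForm haA hx i))
        have h5 := Real.log_le_log (hA.linForm_pos hx i) (hA.linForm_le hB (hone m) h2 i)
        rw [Real.log_mul hS.ne' (Finset.prod_ne_zero_iff.2 fun j _ => by positivity),
          Real.log_prod fun j _ => by positivity] at h5
        have h6 : -(σ i * (Real.log (linForm A x i) - Real.log a)) ≤
            N * (Real.log (linForm A x i) - Real.log a) := by nlinarith [hσ i]
        refine h6.trans (mul_le_mul_of_nonneg_left (by linarith) (Nat.cast_nonneg _))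
      have h5 := Finset.sum_le_sum fun i (_ : i ∈ Finset.univ) => h3 i
      simp only [mul_sub, Finset.sum_neg_distrib, Finset.sum_sub_distrib, Finset.sum_const,
        Finset.card_univ, Fintype.card_fin, nsmul_eq_mul] at h5 ⊢
      linarith
  obtain ⟨c', p, hp, hcp⟩ := key
  refine ⟨Real.exp (c + c' - ∑ i, d i * Real.log a), p, hp, fun m x h1 h2 => ?_⟩
  have hY : ∏ j, ((m j : ℝ) + 1) ^ (-p) = Real.exp (-p * ∑ j, Real.log ((m j : ℝ) + 1)) := by
    rw [Finset.mul_sum, Real.exp_sum]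
    refine Finset.prod_congr rfl fun j _ => ?_
    rw [Real.rpow_def_of_pos (by positivity), mul_comm]
  rw [hY, ← Real.exp_add]
  refine (mul_le_mul_of_nonneg_right (hc m) (Real.exp_nonneg _)).trans ?_
  rw [← Real.exp_add]
  refine Real.exp_le_exp.2 ?_
  have h3 := hcp m x h1 h2
  have h4 := hA.hall_log ha haA (β := fun j => κ + α j) (hone m) h1 (d := d) (fun J => by
    rw [Finset.sum_add_distrib]; simpa [mul_comm] using hD J)
  simp only [add_mul, mul_sub, Finset.sum_add_distrib, Finset.sum_sub_distrib, Nat.cast_add,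
    ← Finset.mul_sum] at h3 h4 ⊢
  linarith

end Bounds

end

/-! ### Weighted sums over shifted lattices -/

section

/-- A finite measure space of bounded weights together with bounded shifts `≥ 1` of the lattice
`ℕ^r`. It describes the (signed) measure on `[1, ∞)^r` obtained by placing the weighted image of the
measure space under the shift at every lattice point. Keeping the measure space abstract makes it
possible to multiply weights by functions of the shift and to average over further shifts. -/
structure ShiftFamily (r : ℕ) where
  /-- The parameter space. -/
  Ω : Type
  [ms : MeasurableSpace Ω]
  /-- The measure on the parameter space. -/
  ν : Measure Ω
  [fin : IsFiniteMeasure ν]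
  /-- The shift of the lattice. -/
  shift : Ω → Fin r → ℝ
  measurable_shift : Measurable shift
  /-- An upper bound of the shifts. -/
  bound : ℝ
  one_le_bound : 1 ≤ bound
  one_le_shift : ∀ ω j, 1 ≤ shift ω j
  shift_le : ∀ ω j, shift ω j ≤ bound
  /-- The weight. -/
  wt : Ω → ℝ
  measurable_wt : Measurable wt
  /-- An upper bound of the absolute values of the weights. -/
  wtBound : ℝ
  abs_wt_le : ∀ ω, |wt ω| ≤ wtBound

attribute [instance] ShiftFamily.ms ShiftFamily.fin

namespace ShiftFamily

variable {n r : ℕ}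

/-- The shifted lattice point `m + b(ω)`. -/
def point (P : ShiftFamily r) (θ : (Fin r → ℕ) × P.Ω) : Fin r → ℝ :=
  fun j => (θ.1 j : ℝ) + P.shift θ.2 j

/-- The measure over which lattice points and shifts are summed. -/
def measure (P : ShiftFamily r) : Measure ((Fin r → ℕ) × P.Ω) := Measure.count.prod P.ν

/-- The weighted summand `w(ω) ∏ (m_j+1)⋯(m_j+α_j) ∏ L_i(m + b(ω)) ^ (-z_i)`. -/
def integrand (A : Matrix (Fin n) (Fin r) ℝ) (P : ShiftFamily r) (α : Fin r → ℕ) (z : Fin n → ℂ)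
    (θ : (Fin r → ℕ) × P.Ω) : ℂ :=
  ((P.wt θ.2 * weight α θ.1 : ℝ) : ℂ) * kernel A z (P.point θ)

/-- The weighted Shintani sum attached to a shift family and a polynomial weight. -/
def shintaniSum (A : Matrix (Fin n) (Fin r) ℝ) (P : ShiftFamily r) (α : Fin r → ℕ)
    (z : Fin n → ℂ) : ℂ :=
  ∫ θ, P.integrand A α z θ ∂P.measure

lemma add_one_le_point (P : ShiftFamily r) (θ : (Fin r → ℕ) × P.Ω) (j : Fin r) :
    (θ.1 j : ℝ) + 1 ≤ P.point θ j := by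
  have := P.one_le_shift θ.2 j
  simp only [point]
  linarith

lemma point_le (P : ShiftFamily r) (θ : (Fin r → ℕ) × P.Ω) (j : Fin r) :
    P.point θ j ≤ P.bound * ((θ.1 j : ℝ) + 1) := by
  have h1 := P.shift_le θ.2 j
  have h2 := P.one_le_bound
  have h3 : (0 : ℝ) ≤ θ.1 j := Nat.cast_nonneg _
  simp only [point]
  nlinarith

lemma one_le_point (P : ShiftFamily r) (θ : (Fin r → ℕ) × P.Ω) (j : Fin r) :
    1 ≤ P.point θ j :=
  le_trans (by simp) (P.add_one_le_point θ j)

lemma measurable_point (P : ShiftFamily r) : Measurable P.point := by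
  refine measurable_pi_lambda _ fun j => ?_
  have h1 : Measurable fun m : Fin r → ℕ => (m j : ℝ) := Measurable.of_discrete
  exact (h1.comp measurable_fst).add
    (((measurable_pi_apply j).comp P.measurable_shift).comp measurable_snd)

lemma measurable_linForm (A : Matrix (Fin n) (Fin r) ℝ) (i : Fin n) :
    Measurable fun x : Fin r → ℝ => linForm A x i := by
  unfold linForm
  fun_prop

lemma measurable_kernel (A : Matrix (Fin n) (Fin r) ℝ) (z : Fin n → ℂ) :
    Measurable (kernel A z) := by
  have : ∀ i, Measurable fun x : Fin r → ℝ => linForm A x i := measurable_linForm A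
  unfold kernel
  fun_prop

lemma measurable_weighted (P : ShiftFamily r) (α : Fin r → ℕ) :
    Measurable fun θ : (Fin r → ℕ) × P.Ω => P.wt θ.2 * weight α θ.1 := by
  have h1 : Measurable (weight α) := Measurable.of_discrete
  exact (P.measurable_wt.comp measurable_snd).mul (h1.comp measurable_fst)

lemma measurable_integrand (A : Matrix (Fin n) (Fin r) ℝ) (P : ShiftFamily r) (α : Fin r → ℕ)
    (z : Fin n → ℂ) : Measurable (P.integrand A α z) :=
  (Complex.measurable_ofReal.comp (P.measurable_weighted α)).mul
    ((measurable_kernel A z).comp P.measurable_point)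

lemma _root_.Shintani.norm_kernel (A : Matrix (Fin n) (Fin r) ℝ) (z : Fin n → ℂ) (x : Fin r → ℝ) :
    ‖kernel A z x‖ = Real.exp (-∑ i, (z i).re * Real.log (linForm A x i)) := by
  rw [kernel, Complex.norm_exp]
  simp

lemma wtBound_nonneg (P : ShiftFamily r) (ω : P.Ω) : 0 ≤ P.wtBound :=
  (abs_nonneg _).trans (P.abs_wt_le ω)

lemma norm_integrand_le (A : Matrix (Fin n) (Fin r) ℝ) (P : ShiftFamily r) (α : Fin r → ℕ)
    (z : Fin n → ℂ) (θ : (Fin r → ℕ) × P.Ω) : ‖P.integrand A α z θ‖ ≤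
      P.wtBound * (weight α θ.1 *
        Real.exp (-∑ i, (z i).re * Real.log (linForm A (P.point θ) i))) := by
  rw [integrand, norm_mul, norm_kernel, Complex.norm_real, norm_mul,
    Real.norm_of_nonneg (weight_nonneg _ _), mul_assoc]
  exact mul_le_mul_of_nonneg_right (P.abs_wt_le _)
    (mul_nonneg (weight_nonneg _ _) (Real.exp_nonneg _))

lemma integrable_of_le_prod_rpow (P : ShiftFamily r) {E : Type*} [NormedAddCommGroup E]
    {f : (Fin r → ℕ) × P.Ω → E}
    (hf : AEStronglyMeasurable f P.measure) {C p : ℝ} (hp : 1 < p)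
    (h : ∀ θ, ‖f θ‖ ≤ C * ∏ j, ((θ.1 j : ℝ) + 1) ^ (-p)) : Integrable f P.measure := by
  have h0 := summable_prod_rpow r hp
  have h1 : Integrable (fun m : Fin r → ℕ => ∏ j, ((m j : ℝ) + 1) ^ (-p)) Measure.count := by
    rw [integrable_count_iff]
    exact h0.norm
  have h2 : Integrable (fun θ : (Fin r → ℕ) × P.Ω => (∏ j, ((θ.1 j : ℝ) + 1) ^ (-p)) * (1 : ℝ))
      P.measure := h1.mul_prod (integrable_const (1 : ℝ))
  refine (h2.const_mul C).mono' hf (ae_of_all _ fun θ => ?_)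
  simpa using h θ

/-- Absolute convergence of weighted Shintani sums with non-negative combinatorial excess. -/
lemma integrable_integrand {A : Matrix (Fin n) (Fin r) ℝ} (hA : IsShintaniMatrix A)
    (P : ShiftFamily r) {α : Fin r → ℕ} {d : Fin n → ℕ}
    (hD : ∀ J : Finset (Fin r), ∑ j ∈ J, α j ≤ ∑ i ∈ rowsOf A J, d i) {s : Fin n → ℂ}
    (hs : ∀ i, (r : ℝ) < (s i).re) :
    Integrable (P.integrand A α (s + fun i => (d i : ℂ))) P.measure := by
  obtain ⟨C, p, hp, hC⟩ := hA.exists_majorant P.one_le_bound (κ := 0) (N := 0)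
    (σ := fun i => (s i).re) (by simpa using hD) (Or.inl hs)
  refine P.integrable_of_le_prod_rpow (P.measurable_integrand A α _).aestronglyMeasurable
    (C := P.wtBound * C) hp fun θ => (P.norm_integrand_le A α _ θ).trans ?_
  rw [mul_assoc]
  refine mul_le_mul_of_nonneg_left ?_ (P.wtBound_nonneg θ.2)
  simpa using hC θ.1 (P.point θ) (P.add_one_le_point θ) (P.point_le θ)

/-- Weighted Shintani sums with large combinatorial excess are analytic in a large region. -/
lemma analyticAt_shintaniSum {A : Matrix (Fin n) (Fin r) ℝ} (hA : IsShintaniMatrix A)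
    (P : ShiftFamily r) {α : Fin r → ℕ} {d : Fin n → ℕ} {N : ℕ}
    (hD : ∀ J : Finset (Fin r), (n * N + 2) * J.card + ∑ j ∈ J, α j ≤ ∑ i ∈ rowsOf A J, d i)
    {p : Fin n → ℂ} (hp : ∀ i, -(N : ℝ) < (p i).re) :
    AnalyticAt ℂ (fun s => P.shintaniSum A α (s + fun i => (d i : ℂ))) p := by
  obtain ⟨a, ha, haA⟩ := hA.exists_pos_le
  obtain ⟨ε, hε, hpε⟩ : ∃ ε : ℝ, 0 < ε ∧ ∀ i, -(N : ℝ) < (p i).re - ε := by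
    have : ∀ i, ∀ᶠ ε in 𝓝[>] (0 : ℝ), -(N : ℝ) < (p i).re - ε := fun i => by
      have hc : Tendsto (fun ε : ℝ => (p i).re - ε) (𝓝[>] 0) (𝓝 ((p i).re - 0)) :=
        (Continuous.tendsto (by fun_prop) 0).mono_left nhdsWithin_le_nhds
      rw [sub_zero] at hc
      exact hc.eventually_const_lt (hp i)
    obtain ⟨ε, h1, h2⟩ := ((eventually_all.2 this).and self_mem_nhdsWithin).exists
    exact ⟨ε, h2, h1⟩
  obtain ⟨C, q, hq, hC⟩ := hA.exists_majorant P.one_le_bound (κ := n * N + 2) (N := N)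
    (σ := fun i => (p i).re - ε) hD (Or.inr ⟨le_rfl, hpε⟩)
  have hl : Measurable fun θ : (Fin r → ℕ) × P.Ω => fun i => Real.log (linForm A (P.point θ) i) :=
    measurable_pi_lambda _ fun i =>
      Real.measurable_log.comp ((measurable_linForm A i).comp P.measurable_point)
  have key : ∀ (s : Fin n → ℂ) θ, P.integrand A α (s + fun i => (d i : ℂ)) θ =
      P.integrand A α (fun i => (d i : ℂ)) θ *
        Complex.exp (-∑ i, s i * (Real.log (linForm A (P.point θ) i) : ℂ)) := by
    intro s θ
    rw [integrand, integrand, mul_assoc, kernel, kernel, ← Complex.exp_add]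
    congr 2
    rw [← neg_add, ← Finset.sum_add_distrib]
    congr 1
    exact Finset.sum_congr rfl fun i _ => by rw [Pi.add_apply]; ring
  simp only [shintaniSum, key]
  refine analyticAt_integral_exp (P.measurable_integrand A α _).aestronglyMeasurable hl p
    (-Real.log a) ε hε (fun θ i => ?_) ?_
  · rw [neg_neg]
    exact Real.log_le_log ha (hA.const_le_linForm haA (P.one_le_point θ) i)
  · refine P.integrable_of_le_prod_rpow (C := P.wtBound * C) ?_ hq fun θ => ?_
    · refine Measurable.aestronglyMeasurable ((P.measurable_integrand A α _).norm.mul ?_)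
      have : ∀ i, Measurable fun θ => Real.log (linForm A (P.point θ) i) :=
        fun i => (measurable_pi_apply i).comp hl
      fun_prop
    · rw [Real.norm_of_nonneg (by positivity)]
      refine (mul_le_mul_of_nonneg_right (P.norm_integrand_le A α _ θ)
        (Real.exp_nonneg _)).trans ?_
      rw [mul_assoc, mul_assoc, mul_assoc, ← Real.exp_add]
      refine mul_le_mul_of_nonneg_left ?_ (P.wtBound_nonneg θ.2)
      refine le_trans (le_of_eq ?_) (hC θ.1 (P.point θ) (P.add_one_le_point θ) (P.point_le θ))
      congr 2
      rw [← neg_add, ← Finset.sum_add_distrib]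
      congr 1
      exact Finset.sum_congr rfl fun i _ => by simp; ring

end ShiftFamily

end

/-! ### Taylor expansion of the kernel and discrete derivatives of the weight -/

section

section Kernel

variable {n r : ℕ} (A : Matrix (Fin n) (Fin r) ℝ)

lemma linForm_add_single (x : Fin r → ℝ) (j : Fin r) (t : ℝ) (i : Fin n) :
    linForm A (x + Pi.single j t) i = linForm A x i + A i j * t := by
  simp only [linForm, Pi.add_apply, mul_add, Finset.sum_add_distrib]
  congr 1
  simp [Pi.single_apply]

lemma kernel_add_single (z : Fin n → ℂ) {x : Fin r → ℝ} {i : Fin n} (hx : 0 < linForm A x i) :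
    kernel A (z + Pi.single i 1) x = kernel A z x / (linForm A x i : ℂ) := by
  have h1 : ∑ k, (z + Pi.single i 1 : Fin n → ℂ) k * (Real.log (linForm A x k) : ℂ) =
      ∑ k, z k * (Real.log (linForm A x k) : ℂ) + (Real.log (linForm A x i) : ℂ) := by
    simp only [Pi.add_apply, add_mul, Finset.sum_add_distrib]
    congr 1
    simp [Pi.single_apply]
  rw [kernel, kernel, h1, neg_add, Complex.exp_add, Complex.exp_neg (Real.log _ : ℂ),
    ← Complex.ofReal_exp, Real.exp_log hx, div_eq_mul_inv]

lemma hasDerivAt_kernel (z : Fin n → ℂ) (x : Fin r → ℝ) (j : Fin r) (t : ℝ)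
    (hx : ∀ i, 0 < linForm A (x + Pi.single j t) i) :
    HasDerivAt (fun t : ℝ => kernel A z (x + Pi.single j t))
      (-∑ i, z i * (A i j : ℂ) * kernel A (z + Pi.single i 1) (x + Pi.single j t)) t := by
  have h1 : ∀ i, HasDerivAt (fun t : ℝ => z i * (Real.log (linForm A (x + Pi.single j t) i) : ℂ))
      (z i * ((A i j / linForm A (x + Pi.single j t) i : ℝ) : ℂ)) t := by
    intro i
    refine HasDerivAt.const_mul _ (HasDerivAt.ofReal_comp ?_)
    have h2 : HasDerivAt (fun t : ℝ => linForm A (x + Pi.single j t) i) (A i j) t := by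
      simp only [linForm_add_single]
      simpa using ((hasDerivAt_id t).const_mul (A i j)).const_add (linForm A x i)
    exact h2.log (hx i).ne'
  have h3 := (HasDerivAt.fun_sum fun i (_ : i ∈ Finset.univ) => h1 i).neg.cexp
  have h4 : Complex.exp (-∑ i, z i * (Real.log (linForm A (x + Pi.single j t) i) : ℂ)) *
      -∑ i, z i * ((A i j / linForm A (x + Pi.single j t) i : ℝ) : ℂ) =
      -∑ i, z i * (A i j : ℂ) * kernel A (z + Pi.single i 1) (x + Pi.single j t) := by
    rw [mul_neg, Finset.mul_sum]
    congr 1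
    refine Finset.sum_congr rfl fun i _ => ?_
    rw [kernel_add_single A z (hx i), kernel]
    push_cast
    ring
  rw [← h4]
  exact h3

lemma integral_unitInterval_eq (f : ℝ → ℂ) :
    ∫ t : unitInterval, f t = ∫ t in (0 : ℝ)..1, f t := by
  rw [intervalIntegral.integral_of_le zero_le_one, ← integral_Icc_eq_integral_Ioc]
  exact unitInterval.measurePreserving_coe.integral_comp unitInterval.measurableEmbedding_coe f

/-- First order Taylor expansion of the kernel in a coordinate direction, with integral remainder. -/
lemma kernel_taylor {A : Matrix (Fin n) (Fin r) ℝ} (hA : IsShintaniMatrix A) (z : Fin n → ℂ)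
    {x : Fin r → ℝ} (hx : ∀ j, 1 ≤ x j) (j : Fin r) :
    kernel A z (x + Pi.single j 1) - kernel A z x =
      -∑ i, z i * (A i j : ℂ) * kernel A (z + Pi.single i 1) x +
      ∫ t : unitInterval, ((1 - t : ℝ) : ℂ) * ∑ i, ∑ k,
        z i * (z + Pi.single i 1 : Fin n → ℂ) k * (A i j : ℂ) * (A k j : ℂ) *
          kernel A (z + Pi.single i 1 + Pi.single k 1) (x + Pi.single j (t : ℝ)) := by
  have hpos : ∀ t : ℝ, 0 ≤ t → ∀ i, 0 < linForm A (x + Pi.single j t) i := fun t ht i => by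
    rw [linForm_add_single]
    exact add_pos_of_pos_of_nonneg (hA.linForm_pos hx i) (mul_nonneg (hA.1 i j) ht)
  let R : ℝ → ℂ := fun t => ((1 - t : ℝ) : ℂ) * ∑ i, ∑ k,
    z i * (z + Pi.single i 1 : Fin n → ℂ) k * (A i j : ℂ) * (A k j : ℂ) *
      kernel A (z + Pi.single i 1 + Pi.single k 1) (x + Pi.single j t)
  change _ = _ + ∫ t : unitInterval, R t
  rw [integral_unitInterval_eq R]
  have h2 : ∀ t : ℝ, 0 ≤ t → HasDerivAt
      (fun t : ℝ => -∑ i, z i * (A i j : ℂ) * kernel A (z + Pi.single i 1) (x + Pi.single j t))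
      (∑ i, ∑ k, z i * (z + Pi.single i 1 : Fin n → ℂ) k * (A i j : ℂ) * (A k j : ℂ) *
          kernel A (z + Pi.single i 1 + Pi.single k 1) (x + Pi.single j t)) t := by
    intro t ht
    have h3 := (HasDerivAt.fun_sum fun i (_ : i ∈ Finset.univ) =>
      (hasDerivAt_kernel A (z + Pi.single i 1) x j t (hpos t ht)).const_mul
        (z i * (A i j : ℂ))).fun_neg
    refine h3.congr_deriv ?_
    rw [← Finset.sum_neg_distrib]
    refine Finset.sum_congr rfl fun i _ => ?_
    rw [mul_neg, neg_neg, Finset.mul_sum]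
    exact Finset.sum_congr rfl fun k _ => by ring
  -- An antiderivative of the remainder's integrand is `h t + (1 - t) h' t`.
  have h4 : ∀ t ∈ Set.uIcc (0 : ℝ) 1, HasDerivAt (fun t : ℝ => kernel A z (x + Pi.single j t) +
      ((1 - t : ℝ) : ℂ) *
        -∑ i, z i * (A i j : ℂ) * kernel A (z + Pi.single i 1) (x + Pi.single j t))
      (R t) t := by
    intro t ht
    rw [Set.uIcc_of_le zero_le_one] at ht
    have h5 : HasDerivAt (fun t : ℝ => ((1 - t : ℝ) : ℂ)) ((-1 : ℝ) : ℂ) t :=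
      ((hasDerivAt_id t).const_sub 1).ofReal_comp
    have h6 := (hasDerivAt_kernel A z x j t (hpos t ht.1)).fun_add (h5.fun_mul (h2 t ht.1))
    refine h6.congr_deriv ?_
    simp only [R]
    push_cast
    ring
  have h7 : ContinuousOn R (Set.uIcc 0 1) := by
    rw [Set.uIcc_of_le zero_le_one]
    refine ContinuousOn.mul (Continuous.continuousOn (by fun_prop)) ?_
    refine continuousOn_finsetSum _ fun i _ => continuousOn_finsetSum _ fun k _ =>
      continuousOn_const.mul fun t ht => ?_
    exact (hasDerivAt_kernel A _ x j t (hpos t ht.1)).continuousAt.continuousWithinAt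
  rw [intervalIntegral.integral_eq_sub_of_hasDerivAt h4 h7.intervalIntegrable]
  simp only [sub_self, sub_zero, Complex.ofReal_zero, Complex.ofReal_one, zero_mul, one_mul,
    add_zero, Pi.single_zero]
  ring

end Kernel

section Weight

variable {r : ℕ}

lemma weight_add_single (α : Fin r → ℕ) (j : Fin r) (m : Fin r → ℕ) :
    weight (α + Pi.single j 1) m = weight α m * ((m j : ℝ) + 1 + α j) := by
  unfold weight
  rw [← Finset.mul_prod_erase Finset.univ _ (Finset.mem_univ j),
    ← Finset.mul_prod_erase Finset.univ (fun j => (((m j + 1).ascFactorial (α j) : ℕ) : ℝ))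
      (Finset.mem_univ j)]
  have : ∏ k ∈ Finset.univ.erase j, (((m k + 1).ascFactorial ((α + Pi.single j 1 : Fin r → ℕ) k) : ℕ) : ℝ) =
      ∏ k ∈ Finset.univ.erase j, (((m k + 1).ascFactorial (α k) : ℕ) : ℝ) := by
    refine Finset.prod_congr rfl fun k hk => ?_
    rw [Pi.add_apply, Pi.single_eq_of_ne (Finset.ne_of_mem_erase hk), add_zero]
  rw [this, Pi.add_apply, Pi.single_eq_same, Nat.ascFactorial_succ]
  push_cast
  ring

/-- The weight `weight (α + e_j)` with its `j`-th factor shifted down by one; it vanishes for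
`m_j = 0`. -/
def lowerWeight (α : Fin r → ℕ) (j : Fin r) (m : Fin r → ℕ) : ℝ :=
  weight α m * m j

/-- The discrete derivative of `lowerWeight` is a multiple of the weight. -/
lemma lowerWeight_add_single (α : Fin r → ℕ) (j : Fin r) (m : Fin r → ℕ) :
    lowerWeight α j (m + Pi.single j 1) = weight (α + Pi.single j 1) m := by
  rw [lowerWeight, weight_add_single]
  unfold weight
  rw [← Finset.mul_prod_erase Finset.univ _ (Finset.mem_univ j),
    ← Finset.mul_prod_erase Finset.univ (fun k => (((m k + 1).ascFactorial (α k) : ℕ) : ℝ))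
      (Finset.mem_univ j)]
  have : ∏ k ∈ Finset.univ.erase j,
      ((((m + Pi.single j 1 : Fin r → ℕ) k + 1).ascFactorial (α k) : ℕ) : ℝ) =
      ∏ k ∈ Finset.univ.erase j, (((m k + 1).ascFactorial (α k) : ℕ) : ℝ) := by
    refine Finset.prod_congr rfl fun k hk => ?_
    rw [Pi.add_apply, Pi.single_eq_of_ne (Finset.ne_of_mem_erase hk), add_zero]
  rw [this]
  simp only [Pi.add_apply, Pi.single_eq_same]
  have h := congrArg (Nat.cast (R := ℝ)) (Nat.succ_ascFactorial (m j + 1) (α j))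
  push_cast at h ⊢
  linear_combination (∏ k ∈ Finset.univ.erase j, (((m k + 1).ascFactorial (α k) : ℕ) : ℝ)) * h

end Weight

end

/-! ### Admissible exponents and operations on shift families -/

section

variable {n r : ℕ}

/-- The combinatorial excess `∑_{i ∈ rowsOf J} d_i - ∑_{j ∈ J} α_j` is non-negative for every set of
columns `J`: every factor `m_j` of the weight can be matched with a factor `L_i⁻¹` in which `m_j`
occurs. -/
def Admissible (A : Matrix (Fin n) (Fin r) ℝ) (d : Fin n → ℕ) (α : Fin r → ℕ) : Prop :=
  ∀ J : Finset (Fin r), ∑ j ∈ J, α j ≤ ∑ i ∈ rowsOf A J, d i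

lemma sum_add_single {ι : Type*} [DecidableEq ι] (S : Finset ι) (f : ι → ℕ) (i : ι) :
    ∑ k ∈ S, (f + Pi.single i 1 : ι → ℕ) k = ∑ k ∈ S, f k + if i ∈ S then 1 else 0 := by
  simp [Finset.sum_add_distrib, Pi.single_apply]

lemma Admissible.add_row {A : Matrix (Fin n) (Fin r) ℝ} {d : Fin n → ℕ} {α : Fin r → ℕ}
    (h : Admissible A d α) (i : Fin n) : Admissible A (d + Pi.single i 1) α := fun J => by
  rw [sum_add_single]
  exact (h J).trans (Nat.le_add_right _ _)

lemma Admissible.add_row_col {A : Matrix (Fin n) (Fin r) ℝ} {d : Fin n → ℕ} {α : Fin r → ℕ}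
    (h : Admissible A d α) {i : Fin n} {j : Fin r} (hij : A i j ≠ 0) :
    Admissible A (d + Pi.single i 1) (α + Pi.single j 1) := fun J => by
  rw [sum_add_single, sum_add_single]
  refine add_le_add (h J) ?_
  split_ifs with h1 h2 <;> try simp
  exact h2 (mem_rowsOf.2 ⟨j, h1, hij⟩)

lemma cast_add_single (d : Fin n → ℕ) (i : Fin n) :
    (fun k => (((d + Pi.single i 1 : Fin n → ℕ) k : ℕ) : ℂ)) =
      (fun k => (d k : ℂ)) + Pi.single i 1 := by
  ext k
  by_cases h : k = i
  · subst h; simp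
  · simp [h]

namespace ShiftFamily

/-- Multiplication of the weights by a bounded measurable function. -/
def mulWt (P : ShiftFamily r) (g : P.Ω → ℝ) (hg : Measurable g) (G : ℝ) (hG : ∀ ω, |g ω| ≤ G) :
    ShiftFamily r where
  Ω := P.Ω
  ν := P.ν
  shift := P.shift
  measurable_shift := P.measurable_shift
  bound := P.bound
  one_le_bound := P.one_le_bound
  one_le_shift := P.one_le_shift
  shift_le := P.shift_le
  wt := fun ω => g ω * P.wt ω
  measurable_wt := hg.mul P.measurable_wt
  wtBound := G * P.wtBound
  abs_wt_le := fun ω => by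
    rw [abs_mul]
    exact mul_le_mul (hG ω) (P.abs_wt_le ω) (abs_nonneg _) ((abs_nonneg _).trans (hG ω))

/-- The family shifted by one further step in the direction of the `j`-th coordinate. -/
@[simps]
def step (P : ShiftFamily r) (j : Fin r) : ShiftFamily r where
  Ω := P.Ω
  ν := P.ν
  shift := fun ω => P.shift ω + Pi.single j 1
  measurable_shift := P.measurable_shift.add_const _
  bound := P.bound + 1
  one_le_bound := by linarith [P.one_le_bound]
  one_le_shift := fun ω k => by
    have h : (0 : ℝ) ≤ (Pi.single j 1 : Fin r → ℝ) k := by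
      rw [Pi.single_apply]; split_ifs <;> norm_num
    have := P.one_le_shift ω k
    rw [Pi.add_apply]
    linarith
  shift_le := fun ω k => by
    have h : (Pi.single j 1 : Fin r → ℝ) k ≤ 1 := by
      rw [Pi.single_apply]; split_ifs <;> norm_num
    have := P.shift_le ω k
    rw [Pi.add_apply]
    linarith
  wt := P.wt
  measurable_wt := P.measurable_wt
  wtBound := P.wtBound
  abs_wt_le := P.abs_wt_le

/-- The family averaged over further shifts by `t ∈ [0, 1]` in the direction of the `j`-th
coordinate, with density `1 - t`. It carries the remainder of a first order Taylor expansion. -/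
@[simps]
def avg (P : ShiftFamily r) (j : Fin r) : ShiftFamily r where
  Ω := P.Ω × unitInterval
  ν := P.ν.prod volume
  shift := fun ω => P.shift ω.1 + Pi.single j (ω.2 : ℝ)
  measurable_shift := by
    refine (P.measurable_shift.comp measurable_fst).add ?_
    have : Continuous fun t : ℝ => (Pi.single j t : Fin r → ℝ) := by
      refine continuous_pi fun k => ?_
      simp only [Pi.single_apply]
      split_ifs <;> fun_prop
    exact this.measurable.comp (measurable_subtype_coe.comp measurable_snd)
  bound := P.bound + 1
  one_le_bound := by linarith [P.one_le_bound]
  one_le_shift := fun ω k => by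
    have h : (0 : ℝ) ≤ (Pi.single j (ω.2 : ℝ) : Fin r → ℝ) k := by
      rw [Pi.single_apply]; split_ifs
      · exact ω.2.2.1
      · exact le_rfl
    have := P.one_le_shift ω.1 k
    rw [Pi.add_apply]
    linarith
  shift_le := fun ω k => by
    have h : (Pi.single j (ω.2 : ℝ) : Fin r → ℝ) k ≤ 1 := by
      rw [Pi.single_apply]; split_ifs
      · exact ω.2.2.2
      · exact zero_le_one
    have := P.shift_le ω.1 k
    rw [Pi.add_apply]
    linarith
  wt := fun ω => P.wt ω.1 * (1 - (ω.2 : ℝ))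
  measurable_wt := by
    have := P.measurable_wt
    fun_prop
  wtBound := P.wtBound
  abs_wt_le := fun ω => by
    have h1 : |1 - (ω.2 : ℝ)| ≤ 1 := abs_le.2 ⟨by linarith [ω.2.2.2], by linarith [ω.2.2.1]⟩
    rw [abs_mul]
    exact (mul_le_of_le_one_right (abs_nonneg _) h1).trans (P.abs_wt_le ω.1)

/-- Integration over shifts averaged in a coordinate direction is an iterated integral. -/
lemma integral_avg (P : ShiftFamily r) (j : Fin r) {f : (Fin r → ℕ) × (P.avg j).Ω → ℂ}
    (hf : Integrable f (P.avg j).measure) :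
    ∫ θ, f θ ∂(P.avg j).measure =
      ∫ θ : (Fin r → ℕ) × P.Ω, (∫ t : unitInterval, f (θ.1, (θ.2, t))) ∂P.measure ∧
    Integrable (fun θ : (Fin r → ℕ) × P.Ω => ∫ t : unitInterval, f (θ.1, (θ.2, t))) P.measure := by
  have hmp := measurePreserving_prodAssoc (Measure.count : Measure (Fin r → ℕ)) P.ν
    (volume : Measure unitInterval)
  have hf' : Integrable (f ∘ MeasurableEquiv.prodAssoc)
      (((Measure.count : Measure (Fin r → ℕ)).prod P.ν).prod (volume : Measure unitInterval)) :=
    (hmp.integrable_comp_emb MeasurableEquiv.prodAssoc.measurableEmbedding).2 hf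
  refine ⟨?_, hf'.integral_prod_left⟩
  have h1 := hmp.integral_comp MeasurableEquiv.prodAssoc.measurableEmbedding f
  have h2 := integral_prod _ hf'
  exact h1.symm.trans h2

/-- Translation of the lattice: a function vanishing for `m_j = 0` has the same integral as its
translate. -/
lemma integral_add_single (P : ShiftFamily r) (j : Fin r) {f : (Fin r → ℕ) × P.Ω → ℂ}
    (hf : Integrable f P.measure)
    (hf' : Integrable (fun θ : (Fin r → ℕ) × P.Ω => f (θ.1 + Pi.single j 1, θ.2)) P.measure)
    (h0 : ∀ θ, θ.1 j = 0 → f θ = 0) :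
    ∫ θ, f (θ.1 + Pi.single j 1, θ.2) ∂P.measure = ∫ θ, f θ ∂P.measure := by
  have e1 := integral_prod_symm _ hf
  have e2 := integral_prod_symm _ hf'
  refine e2.trans (Eq.trans ?_ e1.symm)
  refine integral_congr_ae ?_
  filter_upwards [hf.prod_left_ae, hf'.prod_left_ae] with ω h1 h2
  rw [integral_countable h1, integral_countable h2]
  have hinj : Function.Injective fun m : Fin r → ℕ => m + Pi.single j 1 :=
    fun a b hab => add_right_cancel hab
  have hc : ∀ m : Fin r → ℕ, (Measure.count : Measure (Fin r → ℕ)).real {m} = 1 := fun m => by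
    simp [Measure.real]
  simp only [hc, one_smul]
  refine hinj.tsum_eq (f := fun m => f (m, ω)) fun m hm => ?_
  have hmj : m j ≠ 0 := fun h => hm (h0 (m, ω) h)
  refine ⟨m - Pi.single j 1, ?_⟩
  ext k
  by_cases hk : k = j
  · subst hk
    simp
    omega
  · simp [hk]

end ShiftFamily

end

/-! ### Summation of discrete derivatives -/

section

variable {n r : ℕ} {A : Matrix (Fin n) (Fin r) ℝ}

lemma continuous_kernel_unitInterval (hA : IsShintaniMatrix A) (z : Fin n → ℂ) {x : Fin r → ℝ}
    (hx : ∀ j, 1 ≤ x j) (j : Fin r) :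
    Continuous fun t : unitInterval => kernel A z (x + Pi.single j (t : ℝ)) := by
  refine continuous_iff_continuousAt.2 fun t => ?_
  have h : ∀ i, 0 < linForm A (x + Pi.single j (t : ℝ)) i := fun i => by
    rw [linForm_add_single]
    exact add_pos_of_pos_of_nonneg (hA.linForm_pos hx i) (mul_nonneg (hA.1 i j) t.2.1)
  exact (hasDerivAt_kernel A z x j t h).continuousAt.comp (f := fun t : unitInterval => (t : ℝ))
    continuous_subtype_val.continuousAt

namespace ShiftFamily

/-- The contribution of a single shift to the sum over an averaged family. -/
def avgIntegrand (A : Matrix (Fin n) (Fin r) ℝ) (P : ShiftFamily r) (j : Fin r) (α : Fin r → ℕ)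
    (z : Fin n → ℂ) (θ : (Fin r → ℕ) × P.Ω) : ℂ :=
  ∫ t : unitInterval, (P.avg j).integrand A α z (θ.1, (θ.2, t))

lemma avgIntegrand_eq (P : ShiftFamily r) (j : Fin r) (α : Fin r → ℕ)
    (z : Fin n → ℂ) (θ : (Fin r → ℕ) × P.Ω) : P.avgIntegrand A j α z θ =
      ((P.wt θ.2 * weight α θ.1 : ℝ) : ℂ) *
        ∫ t : unitInterval, ((1 - t : ℝ) : ℂ) * kernel A z (P.point θ + Pi.single j (t : ℝ)) := by
  rw [avgIntegrand, ← integral_const_mul]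
  refine integral_congr_ae (ae_of_all _ fun t => ?_)
  have h : (P.avg j).point (θ.1, (θ.2, t)) = P.point θ + Pi.single j (t : ℝ) := by
    ext k
    simp only [point, avg_shift, Pi.add_apply, add_assoc]
  simp only [integrand, h, avg_wt]
  push_cast
  ring

/-- The pointwise identity behind the recurrence: the discrete derivative, in the direction of the
`j`-th coordinate, of the lowered summand. -/
lemma step_sub_lower (hA : IsShintaniMatrix A) (P : ShiftFamily r) (j : Fin r) (α : Fin r → ℕ)
    (z : Fin n → ℂ) (θ : (Fin r → ℕ) × P.Ω) :
    (P.step j).integrand A (α + Pi.single j 1) z θ -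
        ((P.wt θ.2 * lowerWeight α j θ.1 : ℝ) : ℂ) * kernel A z (P.point θ) =
      ((α j : ℂ) + 1) * P.integrand A α z θ -
      ∑ i, z i * (A i j : ℂ) * P.integrand A (α + Pi.single j 1) (z + Pi.single i 1) θ +
      ∑ i, ∑ k, z i * (z + Pi.single i 1 : Fin n → ℂ) k * (A i j : ℂ) * (A k j : ℂ) *
        P.avgIntegrand A j (α + Pi.single j 1) (z + Pi.single i 1 + Pi.single k 1) θ := by
  have hp : (P.step j).point θ = P.point θ + Pi.single j 1 := by
    ext k
    simp only [point, step_shift, Pi.add_apply, add_assoc]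
  have ht := kernel_taylor hA z (P.one_le_point θ) j
  have hint : ∀ i k, Integrable (fun t : unitInterval => ((1 - t : ℝ) : ℂ) *
      (z i * (z + Pi.single i 1 : Fin n → ℂ) k * (A i j : ℂ) * (A k j : ℂ) *
        kernel A (z + Pi.single i 1 + Pi.single k 1) (P.point θ + Pi.single j (t : ℝ)))) := by
    intro i k
    have hc : Continuous (fun t : unitInterval => ((1 - t : ℝ) : ℂ) *
      (z i * (z + Pi.single i 1 : Fin n → ℂ) k * (A i j : ℂ) * (A k j : ℂ) *
        kernel A (z + Pi.single i 1 + Pi.single k 1) (P.point θ + Pi.single j (t : ℝ)))) :=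
      Continuous.mul (by fun_prop)
        (continuous_const.mul (continuous_kernel_unitInterval hA _ (P.one_le_point θ) j))
    exact hc.integrable_of_hasCompactSupport (HasCompactSupport.of_compactSpace _)
  simp only [Finset.mul_sum] at ht
  rw [integral_finsetSum _ fun i _ => integrable_finsetSum _ fun k _ => hint i k] at ht
  simp only [fun i => integral_finsetSum Finset.univ fun k _ => hint i k] at ht
  have hR : ∀ i k, z i * (z + Pi.single i 1 : Fin n → ℂ) k * (A i j : ℂ) * (A k j : ℂ) *
        P.avgIntegrand A j (α + Pi.single j 1) (z + Pi.single i 1 + Pi.single k 1) θ =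
      ((P.wt θ.2 * weight (α + Pi.single j 1) θ.1 : ℝ) : ℂ) *
        ∫ t : unitInterval, ((1 - t : ℝ) : ℂ) *
      (z i * (z + Pi.single i 1 : Fin n → ℂ) k * (A i j : ℂ) * (A k j : ℂ) *
        kernel A (z + Pi.single i 1 + Pi.single k 1) (P.point θ + Pi.single j (t : ℝ))) := by
    intro i k
    rw [avgIntegrand_eq, mul_left_comm, ← integral_const_mul]
    congr 1
    refine integral_congr_ae (ae_of_all _ fun t => ?_)
    simp only
    ring
  simp only [hR, ← Finset.mul_sum]
  simp only [integrand, hp, step_wt, lowerWeight]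
  have hM : ∀ i, z i * (A i j : ℂ) * (((P.wt θ.2 * weight (α + Pi.single j 1) θ.1 : ℝ) : ℂ) *
      kernel A (z + Pi.single i 1) (P.point θ)) =
      ((P.wt θ.2 * weight (α + Pi.single j 1) θ.1 : ℝ) : ℂ) *
        (z i * (A i j : ℂ) * kernel A (z + Pi.single i 1) (P.point θ)) := fun i => by ring
  simp only [hM, ← Finset.mul_sum]
  rw [sub_eq_iff_eq_add] at ht
  rw [ht, weight_add_single]
  push_cast
  ring

lemma integrable_integrand_of_eq (hA : IsShintaniMatrix A) (P : ShiftFamily r)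
    {α : Fin r → ℕ} {d : Fin n → ℕ} (hD : Admissible A d α) {s z : Fin n → ℂ}
    (hs : ∀ i, (r : ℝ) < (s i).re) (hz : z = s + fun i => (d i : ℂ)) :
    Integrable (P.integrand A α z) P.measure :=
  hz ▸ P.integrable_integrand hA hD hs

/-- Summation of the discrete derivative over the lattice. -/
lemma column_identity (hA : IsShintaniMatrix A) (P : ShiftFamily r) {α : Fin r → ℕ}
    {d : Fin n → ℕ} (hD : Admissible A d α) {s z : Fin n → ℂ}
    (hs : ∀ i, (r : ℝ) + 1 < (s i).re) (hz : z = s + fun i => (d i : ℂ)) (j : Fin r) :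
    ((α j : ℂ) + 1) * P.shintaniSum A α z -
      ∑ i, z i * (A i j : ℂ) * P.shintaniSum A (α + Pi.single j 1) (z + Pi.single i 1) +
      ∑ i, ∑ k, z i * (z + Pi.single i 1 : Fin n → ℂ) k * (A i j : ℂ) * (A k j : ℂ) *
        (P.avg j).shintaniSum A (α + Pi.single j 1) (z + Pi.single i 1 + Pi.single k 1) = 0 := by
  have hs' : ∀ i, (r : ℝ) < (s i).re := fun i => by linarith [hs i]
  -- One spare unit of every real part makes the extra factor `m_j` harmless.
  obtain ⟨i₀, hi₀⟩ := hA.2.2 j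
  have hone : ∀ Q : ShiftFamily r, Integrable (Q.integrand A (α + Pi.single j 1) z) Q.measure := by
    intro Q
    refine Q.integrable_integrand_of_eq hA (hD.add_row_col hi₀.ne') (s := s - Pi.single i₀ 1)
      (fun i => ?_) ?_
    · by_cases h : i = i₀
      · subst h
        simp only [Pi.sub_apply, Pi.single_eq_same, Complex.sub_re, Complex.one_re]
        linarith [hs i]
      · simpa [h] using hs' i
    · rw [cast_add_single, hz]
      abel
  have h1 : Integrable (P.integrand A α z) P.measure :=
    P.integrable_integrand_of_eq hA hD hs' hz
  have h2 : ∀ i, Integrable (fun θ => z i * (A i j : ℂ) *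
      P.integrand A (α + Pi.single j 1) (z + Pi.single i 1) θ) P.measure := by
    intro i
    by_cases h : A i j = 0
    · simp [h]
    · refine Integrable.const_mul (P.integrable_integrand_of_eq hA (hD.add_row_col h) hs' ?_) _
      rw [cast_add_single, hz, add_assoc]
  have h3 : ∀ i k, A i j ≠ 0 → A k j ≠ 0 → Integrable ((P.avg j).integrand A (α + Pi.single j 1)
      (z + Pi.single i 1 + Pi.single k 1)) (P.avg j).measure := by
    intro i k hi hk
    refine (P.avg j).integrable_integrand_of_eq hA ((hD.add_row_col hi).add_row k) hs' ?_
    rw [cast_add_single, cast_add_single, hz]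
    abel
  have h4 : ∀ i k, Integrable (fun θ => z i * (z + Pi.single i 1 : Fin n → ℂ) k *
      (A i j : ℂ) * (A k j : ℂ) * P.avgIntegrand A j (α + Pi.single j 1)
        (z + Pi.single i 1 + Pi.single k 1) θ) P.measure := by
    intro i k
    by_cases hi : A i j = 0
    · simp [hi]
    by_cases hk : A k j = 0
    · simp [hk]
    exact Integrable.const_mul (P.integral_avg j (h3 i k hi hk)).2 _
  have h5 : ∀ i k, z i * (z + Pi.single i 1 : Fin n → ℂ) k * (A i j : ℂ) * (A k j : ℂ) *
      (P.avg j).shintaniSum A (α + Pi.single j 1) (z + Pi.single i 1 + Pi.single k 1) =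
      ∫ θ, z i * (z + Pi.single i 1 : Fin n → ℂ) k * (A i j : ℂ) * (A k j : ℂ) *
        P.avgIntegrand A j (α + Pi.single j 1) (z + Pi.single i 1 + Pi.single k 1) θ
          ∂P.measure := by
    intro i k
    by_cases hi : A i j = 0
    · simp [hi]
    by_cases hk : A k j = 0
    · simp [hk]
    rw [integral_const_mul, shintaniSum, (P.integral_avg j (h3 i k hi hk)).1]
    rfl
  simp only [h5]
  simp only [shintaniSum, ← integral_const_mul]
  have h12 : Integrable (fun θ => ((α j : ℂ) + 1) * P.integrand A α z θ - ∑ i, z i * (A i j : ℂ) *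
      P.integrand A (α + Pi.single j 1) (z + Pi.single i 1) θ) P.measure :=
    (h1.const_mul _).sub (integrable_finsetSum _ fun i _ => h2 i)
  rw [← integral_finsetSum _ fun i _ => h2 i]
  simp only [← fun i => integral_finsetSum Finset.univ fun k _ => h4 i k]
  rw [← integral_finsetSum _ fun i _ => integrable_finsetSum _ fun k _ => h4 i k,
    ← integral_sub (h1.const_mul _) (integrable_finsetSum _ fun i _ => h2 i),
    ← integral_add h12
      (integrable_finsetSum _ fun i _ => integrable_finsetSum _ fun k _ => h4 i k)]
  simp only [← fun θ => P.step_sub_lower hA j α z θ]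
  -- The integrand is now a translate minus the original of a function vanishing for `m_j = 0`.
  have h6 : Integrable (fun θ : (Fin r → ℕ) × P.Ω =>
      ((P.wt θ.2 * lowerWeight α j θ.1 : ℝ) : ℂ) * kernel A z (P.point θ)) P.measure := by
    refine (hone P).mono ?_ (ae_of_all _ fun θ => ?_)
    · have hw : Measurable (lowerWeight α j) := Measurable.of_discrete
      exact ((Complex.measurable_ofReal.comp ((P.measurable_wt.comp measurable_snd).mul
        (hw.comp measurable_fst))).mul
        ((measurable_kernel A z).comp P.measurable_point)).aestronglyMeasurable
    · rw [integrand, norm_mul, norm_mul, Complex.norm_real, Complex.norm_real, norm_mul, norm_mul,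
        Real.norm_of_nonneg (weight_nonneg _ _), weight_add_single, lowerWeight,
        Real.norm_of_nonneg (mul_nonneg (weight_nonneg _ _) (Nat.cast_nonneg _))]
      have := weight_nonneg α θ.1
      have h0 : (0 : ℝ) ≤ α j := Nat.cast_nonneg _
      gcongr
      linarith
  have h7 : (fun θ : (Fin r → ℕ) × P.Ω => ((P.wt θ.2 * lowerWeight α j (θ.1 + Pi.single j 1) : ℝ) : ℂ) *
      kernel A z (P.point (θ.1 + Pi.single j 1, θ.2))) =
      (P.step j).integrand A (α + Pi.single j 1) z := by
    funext θ
    have hp : P.point (θ.1 + Pi.single j 1, θ.2) = (P.step j).point θ := by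
      ext k
      simp only [point, step_shift, Pi.add_apply, Nat.cast_add]
      have : (((Pi.single j 1 : Fin r → ℕ) k : ℕ) : ℝ) = (Pi.single j 1 : Fin r → ℝ) k := by
        by_cases h : k = j
        · subst h; simp
        · simp [h]
      rw [this]
      ring
    rw [hp, lowerWeight_add_single]
    rfl
  have h8 : Integrable ((P.step j).integrand A (α + Pi.single j 1) z) P.measure := hone (P.step j)
  have h9 := P.integral_add_single j h6 (h7 ▸ h8) fun θ hθ => by simp [lowerWeight, hθ]
  refine (integral_sub (μ := P.measure) h8 h6).trans (sub_eq_zero.2 (Eq.trans ?_ h9))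
  exact (congrArg (fun f : (Fin r → ℕ) × P.Ω → ℂ => ∫ θ, f θ ∂P.measure) h7).symm

end ShiftFamily

end

/-! ### The recurrence -/

section

variable {n r : ℕ} {A : Matrix (Fin n) (Fin r) ℝ}

namespace ShiftFamily

/-- The weights multiplied by `∑ j, A i j * (1 + α_j - b_j)`, the discrepancy between
`∑ j, A i j * (m_j + 1 + α_j)` and `L_i(m + b)`. -/
def discrepancy (A : Matrix (Fin n) (Fin r) ℝ) (P : ShiftFamily r) (α : Fin r → ℕ) (i : Fin n) :
    ShiftFamily r :=
  P.mulWt (fun ω => ∑ j, A i j * (1 + α j - P.shift ω j))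
    (by
      have : ∀ j, Measurable fun ω => P.shift ω j := fun j =>
        (measurable_pi_apply j).comp P.measurable_shift
      fun_prop)
    (∑ j, |A i j| * (1 + α j + P.bound))
    (fun ω => by
      refine (Finset.abs_sum_le_sum_abs _ _).trans (Finset.sum_le_sum fun j _ => ?_)
      rw [abs_mul]
      refine mul_le_mul_of_nonneg_left (abs_le.2 ⟨?_, ?_⟩) (abs_nonneg _)
      all_goals
        linarith [P.one_le_shift ω j, P.shift_le ω j, Nat.cast_nonneg (α := ℝ) (α j)])

/-- Expansion of one factor `L_i(m + b)` into the coordinates. -/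
lemma row_identity (hA : IsShintaniMatrix A) (P : ShiftFamily r) {α : Fin r → ℕ}
    {d : Fin n → ℕ} (hD : Admissible A d α) {s z : Fin n → ℂ}
    (hs : ∀ i, (r : ℝ) < (s i).re) (hz : z = s + fun i => (d i : ℂ)) (i : Fin n) :
    ∑ j, (A i j : ℂ) * P.shintaniSum A (α + Pi.single j 1) (z + Pi.single i 1) =
      P.shintaniSum A α z + (P.discrepancy A α i).shintaniSum A α (z + Pi.single i 1) := by
  have hz' : z + Pi.single i 1 = s + fun k => (((d + Pi.single i 1 : Fin n → ℕ) k : ℕ) : ℂ) := by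
    rw [cast_add_single, hz, add_assoc]
  have h1 : ∀ j, Integrable (fun θ => (A i j : ℂ) *
      P.integrand A (α + Pi.single j 1) (z + Pi.single i 1) θ) P.measure := by
    intro j
    by_cases h : A i j = 0
    · simp [h]
    · exact Integrable.const_mul (P.integrable_integrand_of_eq hA (hD.add_row_col h) hs hz') _
  have h2 : Integrable (P.integrand A α z) P.measure := P.integrable_integrand_of_eq hA hD hs hz
  have h3 : Integrable ((P.discrepancy A α i).integrand A α (z + Pi.single i 1)) P.measure :=
    (P.discrepancy A α i).integrable_integrand_of_eq hA (hD.add_row i) hs hz'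
  have h4 : P.shintaniSum A α z + (P.discrepancy A α i).shintaniSum A α (z + Pi.single i 1) =
      ∫ θ, (P.integrand A α z θ + (P.discrepancy A α i).integrand A α (z + Pi.single i 1) θ)
        ∂P.measure := (integral_add (μ := P.measure) h2 h3).symm
  rw [h4]
  simp only [shintaniSum, ← integral_const_mul]
  rw [← integral_finsetSum _ fun j _ => h1 j]
  refine integral_congr_ae (ae_of_all _ fun θ => ?_)
  have hL : 0 < linForm A (P.point θ) i := hA.linForm_pos (P.one_le_point θ) i
  have hL' : (linForm A (P.point θ) i : ℂ) ≠ 0 := Complex.ofReal_ne_zero.2 hL.ne'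
  have hwt : (P.discrepancy A α i).integrand A α (z + Pi.single i 1) θ =
      (((∑ j, A i j * (1 + α j - P.shift θ.2 j)) * P.wt θ.2 * weight α θ.1 : ℝ) : ℂ) *
        kernel A (z + Pi.single i 1) (P.point θ) := rfl
  have hsum : ∑ j, A i j * ((θ.1 j : ℝ) + 1 + α j) =
      linForm A (P.point θ) i + ∑ j, A i j * (1 + α j - P.shift θ.2 j) := by
    rw [linForm, ← Finset.sum_add_distrib]
    refine Finset.sum_congr rfl fun j _ => ?_
    simp only [point]
    ring
  have hl : ∑ j, (A i j : ℂ) * P.integrand A (α + Pi.single j 1) (z + Pi.single i 1) θ =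
      (((∑ j, A i j * ((θ.1 j : ℝ) + 1 + α j)) * P.wt θ.2 * weight α θ.1 : ℝ) : ℂ) *
        kernel A (z + Pi.single i 1) (P.point θ) := by
    simp only [integrand, weight_add_single]
    push_cast
    simp only [Finset.sum_mul]
    exact Finset.sum_congr rfl fun j _ => by ring
  simp only
  rw [hl, hwt, hsum, integrand, kernel_add_single A z hL]
  push_cast
  field_simp

/-- The recurrence: scaling all coordinates in `J` expresses `⟨μ_J, z⟩ - |J| - α(J)` times a
weighted Shintani sum through sums with larger combinatorial excess. -/
theorem recurrence (hA : IsShintaniMatrix A) (P : ShiftFamily r) {α : Fin r → ℕ}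
    {d : Fin n → ℕ} (hD : Admissible A d α) {s z : Fin n → ℂ}
    (hs : ∀ i, (r : ℝ) + 1 < (s i).re) (hz : z = s + fun i => (d i : ℂ)) (J : Finset (Fin r)) :
    (∑ i ∈ rowsOf A J, z i - ∑ j ∈ J, ((α j : ℂ) + 1)) * P.shintaniSum A α z =
      ∑ i ∈ rowsOf A J, (-(z i * (P.discrepancy A α i).shintaniSum A α (z + Pi.single i 1)) +
        ∑ j ∈ Jᶜ, (A i j : ℂ) * (z i *
          P.shintaniSum A (α + Pi.single j 1) (z + Pi.single i 1))) +
      ∑ j ∈ J, ∑ i, ∑ k, (A i j : ℂ) * (A k j : ℂ) *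
        ((z i * (z + Pi.single i 1 : Fin n → ℂ) k) *
        (P.avg j).shintaniSum A (α + Pi.single j 1) (z + Pi.single i 1 + Pi.single k 1)) := by
  have h1 := Finset.sum_eq_zero fun j (_ : j ∈ J) => P.column_identity hA hD hs hz j
  rw [Finset.sum_add_distrib, Finset.sum_sub_distrib, ← Finset.sum_mul] at h1
  have h2 : ∑ j ∈ J, ∑ i, z i * (A i j : ℂ) *
      P.shintaniSum A (α + Pi.single j 1) (z + Pi.single i 1) =
      ∑ i ∈ rowsOf A J, ∑ j ∈ J, z i * (A i j : ℂ) *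
        P.shintaniSum A (α + Pi.single j 1) (z + Pi.single i 1) := by
    rw [Finset.sum_comm]
    refine (Finset.sum_subset (Finset.subset_univ _) fun i _ hi => ?_).symm
    refine Finset.sum_eq_zero fun j hj => ?_
    have : A i j = 0 := by
      by_contra hne
      exact hi (mem_rowsOf.2 ⟨j, hj, hne⟩)
    simp [this]
  have h3 : ∀ i, ∑ j ∈ J, z i * (A i j : ℂ) *
      P.shintaniSum A (α + Pi.single j 1) (z + Pi.single i 1) = z i * P.shintaniSum A α z +
      z i * (P.discrepancy A α i).shintaniSum A α (z + Pi.single i 1) -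
      ∑ j ∈ Jᶜ, (A i j : ℂ) * (z i *
          P.shintaniSum A (α + Pi.single j 1) (z + Pi.single i 1)) := by
    intro i
    have h4 := P.row_identity hA hD (fun i => by linarith [hs i]) hz i
    rw [← Finset.sum_add_sum_compl J] at h4
    rw [← mul_add, ← h4, mul_add, Finset.mul_sum, Finset.mul_sum]
    rw [add_sub_assoc, ← Finset.sum_sub_distrib]
    rw [Finset.sum_eq_zero (s := Jᶜ) (fun j _ => by ring), add_zero]
    exact Finset.sum_congr rfl fun j _ => by ring
  have h5 : ∑ j ∈ J, ∑ i, ∑ k, z i * (z + Pi.single i 1 : Fin n → ℂ) k * (A i j : ℂ) * (A k j : ℂ) *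
        (P.avg j).shintaniSum A (α + Pi.single j 1) (z + Pi.single i 1 + Pi.single k 1) =
      ∑ j ∈ J, ∑ i, ∑ k, (A i j : ℂ) * (A k j : ℂ) *
        ((z i * (z + Pi.single i 1 : Fin n → ℂ) k) *
        (P.avg j).shintaniSum A (α + Pi.single j 1) (z + Pi.single i 1 + Pi.single k 1)) :=
    Finset.sum_congr rfl fun j _ => Finset.sum_congr rfl fun i _ => Finset.sum_congr rfl fun k _ =>
      by ring
  rw [h2, h5] at h1
  simp only [h3] at h1
  simp only [Finset.sum_sub_distrib, Finset.sum_add_distrib, ← Finset.sum_mul,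
    Finset.sum_neg_distrib] at h1 ⊢
  linear_combination -h1

end ShiftFamily

end

/-! ### Closed sets of columns and the denominators -/

section

variable {n r : ℕ}

/-- The combinatorial excess `∑_{i ∈ rowsOf J} d_i - ∑_{j ∈ J} α_j`, as a natural number; the
truncated subtraction is harmless for admissible exponents. -/
def excess (A : Matrix (Fin n) (Fin r) ℝ) (d : Fin n → ℕ) (α : Fin r → ℕ) (J : Finset (Fin r)) : ℕ :=
  ∑ i ∈ rowsOf A J, d i - ∑ j ∈ J, α j

/-- All columns supported in the rows which meet `J`. -/
def colClosure (A : Matrix (Fin n) (Fin r) ℝ) (J : Finset (Fin r)) : Finset (Fin r) := by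
  classical exact {j | ∀ i, A i j ≠ 0 → i ∈ rowsOf A J}

open Classical in
/-- The non-empty sets of columns which contain every column supported in their rows. -/
def closedSets (A : Matrix (Fin n) (Fin r) ℝ) : Finset (Finset (Fin r)) :=
  {J | J.Nonempty ∧ colClosure A J = J}

lemma mem_colClosure {A : Matrix (Fin n) (Fin r) ℝ} {J : Finset (Fin r)} {j : Fin r} :
    j ∈ colClosure A J ↔ ∀ i, A i j ≠ 0 → i ∈ rowsOf A J := by
  simp [colClosure]

lemma mem_closedSets {A : Matrix (Fin n) (Fin r) ℝ} {J : Finset (Fin r)} :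
    J ∈ closedSets A ↔ J.Nonempty ∧ colClosure A J = J := by
  simp [closedSets]

lemma subset_colClosure (A : Matrix (Fin n) (Fin r) ℝ) (J : Finset (Fin r)) :
    J ⊆ colClosure A J := fun j hj =>
  mem_colClosure.2 fun _ hi => mem_rowsOf.2 ⟨j, hj, hi⟩

lemma rowsOf_colClosure (A : Matrix (Fin n) (Fin r) ℝ) (J : Finset (Fin r)) :
    rowsOf A (colClosure A J) = rowsOf A J := by
  ext i
  refine ⟨fun hi => ?_, fun hi => ?_⟩
  · obtain ⟨j, hj, hij⟩ := mem_rowsOf.1 hi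
    exact mem_colClosure.1 hj i hij
  · obtain ⟨j, hj, hij⟩ := mem_rowsOf.1 hi
    exact mem_rowsOf.2 ⟨j, subset_colClosure A J hj, hij⟩

lemma colClosure_mem_closedSets {A : Matrix (Fin n) (Fin r) ℝ} {J : Finset (Fin r)}
    (hJ : J.Nonempty) : colClosure A J ∈ closedSets A := by
  refine mem_closedSets.2 ⟨hJ.mono (subset_colClosure A J), ?_⟩
  ext j
  rw [mem_colClosure, mem_colClosure, rowsOf_colClosure]

/-- Closed sets of columns are determined by the rows which they meet. -/
lemma rowsOf_injOn_closedSets (A : Matrix (Fin n) (Fin r) ℝ) :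
    Set.InjOn (rowsOf A) (closedSets A : Set (Finset (Fin r))) := by
  intro J hJ K hK h
  rw [← (mem_closedSets.1 hJ).2, ← (mem_closedSets.1 hK).2]
  ext j
  rw [mem_colClosure, mem_colClosure, h]

open MvPolynomial

/-- The affine form `⟨μ_J, s⟩ - (|J| - l)`. -/
def hyperplanePoly (A : Matrix (Fin n) (Fin r) ℝ) (J : Finset (Fin r)) (l : ℕ) :
    MvPolynomial (Fin n) ℂ :=
  ∑ i ∈ rowsOf A J, X i + C ((l : ℂ) - J.card)

lemma eval_hyperplanePoly (A : Matrix (Fin n) (Fin r) ℝ) (J : Finset (Fin r)) (l : ℕ)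
    (s : Fin n → ℂ) :
    eval s (hyperplanePoly A J l) = ∑ i ∈ rowsOf A J, s i + ((l : ℂ) - J.card) := by
  simp [hyperplanePoly]

/-- The affine forms of non-empty sets do not vanish where all real parts are large. -/
lemma eval_hyperplanePoly_ne_zero {A : Matrix (Fin n) (Fin r) ℝ} (hA : IsShintaniMatrix A)
    {J : Finset (Fin r)} (hJ : J.Nonempty) (l : ℕ) {s : Fin n → ℂ} (hs : ∀ i, (r : ℝ) < (s i).re) :
    eval s (hyperplanePoly A J l) ≠ 0 := by
  intro h
  have h1 := congrArg Complex.re h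
  obtain ⟨j, hj⟩ := hJ
  obtain ⟨i, hi⟩ := hA.2.2 j
  have h2 : (s i).re ≤ ∑ i ∈ rowsOf A J, (s i).re :=
    Finset.single_le_sum (f := fun i => (s i).re)
      (fun k _ => (Nat.cast_nonneg r).trans (hs k).le) (mem_rowsOf.2 ⟨j, hj, hi.ne'⟩)
  have h3 : (J.card : ℝ) ≤ r := Nat.cast_le.2 (by simpa using Finset.card_le_univ J)
  rw [eval_hyperplanePoly] at h1
  simp only [Complex.add_re, Complex.re_sum, Complex.sub_re, Complex.natCast_re,
    Complex.zero_re] at h1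
  linarith [hs i, Nat.cast_nonneg (α := ℝ) l]

/-- The end of the range of `l` for which the affine form of `(J, l)` occurs in the denominator of a
weighted Shintani sum. If `J` meets a single row `i`, the forms with larger `l` are cancelled by
the factors `s_i (s_i + 1) ⋯` which accompany an increase of the exponent `d_i`; otherwise the
range is only limited by the truncation parameter `M`. -/
def upper (A : Matrix (Fin n) (Fin r) ℝ) (M : ℕ) (d : Fin n → ℕ) (J : Finset (Fin r)) : ℕ :=
  if (rowsOf A J).card = 1 then J.card + ∑ i ∈ rowsOf A J, d i else M

/-- The denominator of a weighted Shintani sum. -/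
def denom (A : Matrix (Fin n) (Fin r) ℝ) (M : ℕ) (d : Fin n → ℕ) (α : Fin r → ℕ) :
    MvPolynomial (Fin n) ℂ :=
  ∏ J ∈ closedSets A, ∏ l ∈ Finset.Ico (excess A d α J) (upper A M d J), hyperplanePoly A J l

/-- The product of `(s_i + d_i) ⋯ (s_i + d'_i - 1)` over all rows. -/
def pochPoly (d d' : Fin n → ℕ) : MvPolynomial (Fin n) ℂ :=
  ∏ i, ∏ k ∈ Finset.Ico (d i) (d' i), (X i + C (k : ℂ))

lemma pochPoly_self (d : Fin n → ℕ) : pochPoly d d = 1 := by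
  simp [pochPoly]

lemma eval_pochPoly_add_single {d d' : Fin n → ℕ} (h : d ≤ d') (i : Fin n) (s : Fin n → ℂ) :
    eval s (pochPoly d (d' + Pi.single i 1)) = eval s (pochPoly d d') * (s i + d' i) := by
  unfold pochPoly
  rw [← Finset.mul_prod_erase Finset.univ _ (Finset.mem_univ i),
    ← Finset.mul_prod_erase Finset.univ
      (fun i => ∏ k ∈ Finset.Ico (d i) (d' i), (X i + C (k : ℂ))) (Finset.mem_univ i)]
  have h1 : ∏ k ∈ Finset.univ.erase i, (∏ l ∈ Finset.Ico (d k)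
      ((d' + Pi.single i 1 : Fin n → ℕ) k), (X k + C (l : ℂ)) : MvPolynomial (Fin n) ℂ) =
      ∏ k ∈ Finset.univ.erase i, ∏ l ∈ Finset.Ico (d k) (d' k), (X k + C (l : ℂ)) := by
    refine Finset.prod_congr rfl fun k hk => ?_
    rw [Pi.add_apply, Pi.single_eq_of_ne (Finset.ne_of_mem_erase hk), add_zero]
  rw [h1, Pi.add_apply, Pi.single_eq_same, Finset.prod_Ico_succ_top (h i)]
  simp only [map_mul, map_add, eval_X, eval_C]
  ring

/-- The factors by which the denominators attached to single rows grow divide `pochPoly`: distinct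
closed sets meet distinct sets of rows, so no row is used twice. -/
lemma prod_closedSets_dvd_pochPoly (A : Matrix (Fin n) (Fin r) ℝ) (d d' : Fin n → ℕ) :
    (∏ J ∈ closedSets A, if (rowsOf A J).card = 1 then
      ∏ i ∈ rowsOf A J, ∏ k ∈ Finset.Ico (d i) (d' i), (X i + C (k : ℂ) : MvPolynomial (Fin n) ℂ)
      else 1) ∣ pochPoly d d' := by
  classical
  rw [← Finset.prod_filter]
  rw [← Finset.prod_image (f := fun I : Finset (Fin n) => ∏ i ∈ I, ∏ k ∈ Finset.Ico (d i) (d' i),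
    (X i + C (k : ℂ) : MvPolynomial (Fin n) ℂ)) (g := rowsOf A)
    fun J hJ K hK h => rowsOf_injOn_closedSets A (Finset.mem_filter.1 hJ).1
      (Finset.mem_filter.1 hK).1 h]
  have h1 : pochPoly d d' = ∏ I ∈ Finset.univ.image fun i : Fin n => ({i} : Finset (Fin n)),
      ∏ i ∈ I, ∏ k ∈ Finset.Ico (d i) (d' i), (X i + C (k : ℂ) : MvPolynomial (Fin n) ℂ) := by
    rw [Finset.prod_image fun i _ k _ h => Finset.singleton_injective h]
    simp [pochPoly]
  rw [h1]
  refine Finset.prod_dvd_prod_of_subset _ _ _ fun I hI => ?_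
  obtain ⟨J, hJ, rfl⟩ := Finset.mem_image.1 hI
  obtain ⟨i, hi⟩ := Finset.card_eq_one.1 (Finset.mem_filter.1 hJ).2
  exact Finset.mem_image.2 ⟨i, Finset.mem_univ _, hi.symm⟩

/-- Divisibility between the denominators of the two sides of the recurrence. -/
lemma hyperplanePoly_mul_denom_dvd {A : Matrix (Fin n) (Fin r) ℝ} {M : ℕ} {d d' : Fin n → ℕ}
    {α α' : Fin r → ℕ} {J₀ : Finset (Fin r)} (hJ₀ : J₀ ∈ closedSets A)
    (hM : excess A d α J₀ < M) (hd : d ≤ d') (hmono : ∀ J, excess A d α J ≤ excess A d' α' J)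
    (hlt : excess A d α J₀ < excess A d' α' J₀) :
    hyperplanePoly A J₀ (excess A d α J₀) * denom A M d' α' ∣ pochPoly d d' * denom A M d α := by
  classical
  have hsum : ∀ J, ∑ i ∈ rowsOf A J, d i ≤ ∑ i ∈ rowsOf A J, d' i := fun J =>
    Finset.sum_le_sum fun i _ => hd i
  have hexc : ∀ J, excess A d α J ≤ ∑ i ∈ rowsOf A J, d i := fun J => Nat.sub_le _ _
  have h1 : hyperplanePoly A J₀ (excess A d α J₀) * denom A M d' α' = ∏ J ∈ closedSets A,
      ((if J₀ = J then hyperplanePoly A J (excess A d α J) else 1) *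
        ∏ l ∈ Finset.Ico (excess A d' α' J) (upper A M d' J), hyperplanePoly A J l) := by
    rw [Finset.prod_mul_distrib, Finset.prod_ite_eq, if_pos hJ₀, denom]
  -- After multiplication by `pochPoly`, the ranges of `l` extend to the new upper ends.
  have h2 : (∏ J ∈ closedSets A, if (rowsOf A J).card = 1 then
      ∏ i ∈ rowsOf A J, ∏ k ∈ Finset.Ico (d i) (d' i), (X i + C (k : ℂ) : MvPolynomial (Fin n) ℂ)
      else 1) * denom A M d α = ∏ J ∈ closedSets A,
        ∏ l ∈ Finset.Ico (excess A d α J) (upper A M d' J), hyperplanePoly A J l := by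
    rw [denom, ← Finset.prod_mul_distrib]
    refine Finset.prod_congr rfl fun J hJ => ?_
    by_cases hc : (rowsOf A J).card = 1
    · obtain ⟨i, hi⟩ := Finset.card_eq_one.1 hc
      have h3 := hexc J
      have h4 : d i ≤ d' i := hd i
      simp only [upper, if_pos hc]
      simp only [hi, Finset.sum_singleton, Finset.prod_singleton] at h3 ⊢
      have h5 : ∏ k ∈ Finset.Ico (d i) (d' i), (X i + C (k : ℂ) : MvPolynomial (Fin n) ℂ) =
          ∏ l ∈ Finset.Ico (J.card + d i) (J.card + d' i), hyperplanePoly A J l := by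
        rw [add_comm J.card, add_comm J.card,
          ← Finset.prod_Ico_add (fun l => hyperplanePoly A J l) (d i) (d' i) J.card]
        refine Finset.prod_congr rfl fun k _ => ?_
        rw [hyperplanePoly, hi, Finset.sum_singleton]
        push_cast
        rw [add_sub_cancel_left]
      rw [h5, mul_comm, Finset.prod_Ico_consecutive _ (by omega) (by omega)]
    · simp [upper, hc]
  refine dvd_trans ?_ (mul_dvd_mul_right (prod_closedSets_dvd_pochPoly A d d') _)
  rw [h1, h2]
  refine Finset.prod_dvd_prod_of_dvd _ _ fun J hJ => ?_
  have hne : 0 < J.card := Finset.card_pos.2 (mem_closedSets.1 hJ).1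
  split_ifs with hJJ
  -- For `J₀` the range loses its lower end, which is taken by the affine form on the left.
  · subst hJJ
    rw [← Finset.prod_insert (by simp [hlt])]
    refine Finset.prod_dvd_prod_of_subset _ _ _ (Finset.insert_subset ?_
      (Finset.Ico_subset_Ico_left hlt.le))
    refine Finset.mem_Ico.2 ⟨le_rfl, ?_⟩
    have h3 := hexc J₀
    have h4 := hsum J₀
    unfold upper
    split_ifs
    · omega
    · exact hM
  · rw [one_mul]
    exact Finset.prod_dvd_prod_of_subset _ _ _ (Finset.Ico_subset_Ico_left (hmono J))

end

/-! ### Analytic continuation of weighted sums -/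

section

open MvPolynomial

variable {n r : ℕ}

/-- The points of `ℂⁿ` all of whose coordinates have real part greater than `c`. -/
def reGt (n : ℕ) (c : ℝ) : Set (Fin n → ℂ) := {s | ∀ i, c < (s i).re}

/-- `Q_{d,α}(s) · S(s + d)` extends analytically from a region of absolute convergence to the region
where all real parts exceed `-N`. Here `S` is the weighted Shintani sum and `Q_{d,α}` its
denominator. -/
def HasContinuation (A : Matrix (Fin n) (Fin r) ℝ) (N M : ℕ) (P : ShiftFamily r) (d : Fin n → ℕ)
    (α : Fin r → ℕ) : Prop :=
  ∃ E : (Fin n → ℂ) → ℂ, AnalyticOnNhd ℂ E (reGt n (-N)) ∧ ∀ s ∈ reGt n (r + 1),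
    eval s (denom A M d α) * P.shintaniSum A α (s + fun i => (d i : ℂ)) = E s

/-- `Q · f` agrees, in a region of absolute convergence, with `q` times a function that is analytic
where all real parts exceed `-N`. -/
def Regular {n : ℕ} (r N : ℕ) (Q q : MvPolynomial (Fin n) ℂ) (f : (Fin n → ℂ) → ℂ) : Prop :=
  ∃ E : (Fin n → ℂ) → ℂ, AnalyticOnNhd ℂ E (reGt n (-N)) ∧ ∀ s ∈ reGt n (r + 1),
    eval s Q * f s = eval s q * E s

namespace Regular

variable {N : ℕ} {Q q : MvPolynomial (Fin n) ℂ}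

lemma zero : Regular r N Q q fun _ => 0 :=
  ⟨fun _ => 0, fun _ _ => analyticAt_const, by simp⟩

lemma add {f g : (Fin n → ℂ) → ℂ} (hf : Regular r N Q q f) (hg : Regular r N Q q g) :
    Regular r N Q q fun s => f s + g s := by
  obtain ⟨E, hE, hE'⟩ := hf
  obtain ⟨F, hF, hF'⟩ := hg
  exact ⟨fun s => E s + F s, fun s hs => (hE s hs).add (hF s hs), fun s hs => by
    rw [mul_add, hE' s hs, hF' s hs, mul_add]⟩

lemma const_mul (c : ℂ) {f : (Fin n → ℂ) → ℂ} (hf : Regular r N Q q f) :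
    Regular r N Q q fun s => c * f s := by
  obtain ⟨E, hE, hE'⟩ := hf
  exact ⟨fun s => c * E s, fun s hs => analyticAt_const.mul (hE s hs), fun s hs => by
    rw [mul_left_comm, hE' s hs, mul_left_comm]⟩

lemma neg {f : (Fin n → ℂ) → ℂ} (hf : Regular r N Q q f) : Regular r N Q q fun s => -f s := by
  simpa using hf.const_mul (-1)

lemma sum {ι : Type*} {S : Finset ι} {f : ι → (Fin n → ℂ) → ℂ}
    (hf : ∀ i ∈ S, Regular r N Q q (f i)) : Regular r N Q q fun s => ∑ i ∈ S, f i s := by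
  classical
  induction S using Finset.induction_on with
  | empty => simpa using zero
  | insert a S ha ih =>
    simp only [Finset.sum_insert ha]
    exact (hf a (Finset.mem_insert_self a S)).add
      (ih fun i hi => hf i (Finset.mem_insert_of_mem hi))

end Regular

/-- A continued term on the right-hand side of the recurrence remains regular after division by the
affine form on the left-hand side. -/
lemma HasContinuation.regular {A : Matrix (Fin n) (Fin r) ℝ} {N M : ℕ} {P : ShiftFamily r}
    {d d' : Fin n → ℕ} {α α' : Fin r → ℕ} (h : HasContinuation A N M P d' α')
    {J₀ : Finset (Fin r)} (hJ₀ : J₀ ∈ closedSets A)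
    (hM : excess A d α J₀ < M) (hd : d ≤ d') (hmono : ∀ J, excess A d α J ≤ excess A d' α' J)
    (hlt : excess A d α J₀ < excess A d' α' J₀) {c : (Fin n → ℂ) → ℂ}
    (hc : ∀ s, c s = eval s (pochPoly d d')) {z : (Fin n → ℂ) → Fin n → ℂ}
    (hz : ∀ s, z s = s + fun i => (d' i : ℂ)) :
    Regular r N (denom A M d α) (hyperplanePoly A J₀ (excess A d α J₀))
      fun s => c s * P.shintaniSum A α' (z s) := by
  obtain ⟨k, hk⟩ := hyperplanePoly_mul_denom_dvd hJ₀ hM hd hmono hlt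
  obtain ⟨E, hE, hE'⟩ := h
  refine ⟨fun s => eval s k * E s, fun s hs =>
    (AnalyticOnNhd.eval_mvPolynomial k s (Set.mem_univ s)).mul (hE s hs), fun s hs => ?_⟩
  have h1 := congrArg (eval s) hk
  simp only [map_mul] at h1
  simp only
  rw [hc, hz, ← hE' s hs]
  linear_combination (P.shintaniSum A α' (s + fun i => (d' i : ℂ))) * h1

lemma hasContinuation_of_large_excess {A : Matrix (Fin n) (Fin r) ℝ} (hA : IsShintaniMatrix A)
    {N : ℕ} (P : ShiftFamily r) {d : Fin n → ℕ} {α : Fin r → ℕ} (hD : Admissible A d α)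
    (h : ∀ J ∈ closedSets A, (n * N + 2) * r ≤ excess A d α J) :
    HasContinuation A N ((n * N + 2) * r) P d α := by
  refine ⟨fun s => eval s (denom A ((n * N + 2) * r) d α) *
    P.shintaniSum A α (s + fun i => (d i : ℂ)), fun s hs =>
    (AnalyticOnNhd.eval_mvPolynomial _ s (Set.mem_univ s)).mul
      (P.analyticAt_shintaniSum hA (fun J => ?_) hs), fun s _ => rfl⟩
  rcases J.eq_empty_or_nonempty with rfl | hJ
  · simp
  -- The excess of `J` is at least that of its closure, which meets the same rows.
  have h1 := h _ (colClosure_mem_closedSets hJ)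
  have h2 := hD (colClosure A J)
  unfold excess at h1
  rw [rowsOf_colClosure] at h1 h2
  have h3 : ∑ j ∈ J, α j ≤ ∑ j ∈ colClosure A J, α j :=
    Finset.sum_le_sum_of_subset (subset_colClosure A J)
  have h4 : (n * N + 2) * J.card ≤ (n * N + 2) * r :=
    Nat.mul_le_mul_left _ (by simpa using Finset.card_le_univ J)
  omega

/-- Analytic continuation of all weighted Shintani sums, by induction on the missing excess. -/
theorem hasContinuation {A : Matrix (Fin n) (Fin r) ℝ} (hA : IsShintaniMatrix A) (N : ℕ)
    (P : ShiftFamily r) {d : Fin n → ℕ} {α : Fin r → ℕ} (hD : Admissible A d α) :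
    HasContinuation A N ((n * N + 2) * r) P d α := by
  set M := (n * N + 2) * r with hMdef
  induction hK : ∑ J ∈ closedSets A, (M - excess A d α J) using Nat.strong_induction_on
    generalizing P d α with
  | _ K ih =>
  by_cases hbig : ∀ J ∈ closedSets A, M ≤ excess A d α J
  · exact hasContinuation_of_large_excess hA P hD hbig
  push Not at hbig
  obtain ⟨J₀, hJ₀, hM⟩ := hbig
  -- Terms with larger excess are covered by the induction hypothesis.
  have hstep : ∀ (P' : ShiftFamily r) {d' : Fin n → ℕ} {α' : Fin r → ℕ}, Admissible A d' α' →
      d ≤ d' → (∀ J, excess A d α J ≤ excess A d' α' J) →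
      excess A d α J₀ < excess A d' α' J₀ → ∀ {c : (Fin n → ℂ) → ℂ},
      (∀ s, c s = eval s (pochPoly d d')) → ∀ {z : (Fin n → ℂ) → Fin n → ℂ},
      (∀ s, z s = s + fun i => (d' i : ℂ)) →
      Regular r N (denom A M d α) (hyperplanePoly A J₀ (excess A d α J₀))
        fun s => c s * P'.shintaniSum A α' (z s) := by
    intro P' d' α' hD' hd hmono hlt c hc z hz
    refine (ih _ ?_ P' hD' rfl).regular hJ₀ hM hd hmono hlt hc hz
    rw [← hK]
    exact Finset.sum_lt_sum (fun J _ => Nat.sub_le_sub_left (hmono J) M) ⟨J₀, hJ₀, by omega⟩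
  have hle1 : ∀ i, d ≤ d + Pi.single i 1 := fun i => le_self_add
  have hp1 : ∀ i s, s i + (d i : ℂ) = eval s (pochPoly d (d + Pi.single i 1)) := fun i s => by
    rw [eval_pochPoly_add_single le_rfl, pochPoly_self, map_one, one_mul]
  have hz1 : ∀ (i : Fin n) (s : Fin n → ℂ), (s + fun i => (d i : ℂ)) + Pi.single i 1 =
      s + fun k => (((d + Pi.single i 1 : Fin n → ℕ) k : ℕ) : ℂ) := fun i s => by
    rw [cast_add_single, add_assoc]
  have hrec : Regular r N (denom A M d α) (hyperplanePoly A J₀ (excess A d α J₀)) fun s =>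
      ∑ i ∈ rowsOf A J₀, (-((s i + (d i : ℂ)) * (P.discrepancy A α i).shintaniSum A α
          ((s + fun i => (d i : ℂ)) + Pi.single i 1)) +
        ∑ j ∈ J₀ᶜ, (A i j : ℂ) * ((s i + (d i : ℂ)) *
          P.shintaniSum A (α + Pi.single j 1) ((s + fun i => (d i : ℂ)) + Pi.single i 1))) +
      ∑ j ∈ J₀, ∑ i, ∑ k, (A i j : ℂ) * (A k j : ℂ) *
        (((s i + (d i : ℂ)) * ((s + fun i => (d i : ℂ)) + Pi.single i 1 : Fin n → ℂ) k) *
        (P.avg j).shintaniSum A (α + Pi.single j 1)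
          ((s + fun i => (d i : ℂ)) + Pi.single i 1 + Pi.single k 1)) := by
    refine Regular.add (Regular.sum fun i hi => Regular.add (Regular.neg ?_)
      (Regular.sum fun j hj => ?_)) (Regular.sum fun j hj => Regular.sum fun i _ =>
        Regular.sum fun k _ => ?_)
    · refine hstep _ (hD.add_row i) (hle1 i) (fun J => ?_) ?_ (hp1 i) (hz1 i)
      · unfold excess
        rw [sum_add_single]
        omega
      · have := hD J₀
        unfold excess
        rw [sum_add_single, if_pos hi]
        omega
    · by_cases hij : A i j = 0
      · simpa [hij] using Regular.zero
      refine Regular.const_mul _ (hstep _ (hD.add_row_col hij) (hle1 i) (fun J => ?_) ?_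
        (hp1 i) (hz1 i))
      · have h1 := hD J
        have h2 : j ∈ J → i ∈ rowsOf A J := fun h => mem_rowsOf.2 ⟨j, h, hij⟩
        unfold excess
        rw [sum_add_single, sum_add_single]
        split_ifs with h3 h4 <;> first | omega | exact absurd (h2 ‹_›) ‹_›
      · have := hD J₀
        unfold excess
        rw [sum_add_single, sum_add_single, if_pos hi, if_neg (Finset.mem_compl.1 hj)]
        omega
    · by_cases hij : A i j = 0
      · simpa [hij] using Regular.zero
      by_cases hkj : A k j = 0
      · simpa [hkj] using Regular.zero
      refine Regular.const_mul _ (hstep _ ((hD.add_row_col hij).add_row k)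
        ((hle1 i).trans le_self_add) (fun J => ?_) ?_ (fun s => ?_) (fun s => ?_))
      · have h1 := hD J
        have h2 : j ∈ J → i ∈ rowsOf A J := fun h => mem_rowsOf.2 ⟨j, h, hij⟩
        unfold excess
        rw [sum_add_single, sum_add_single, sum_add_single]
        split_ifs <;> first | omega | exact absurd (h2 ‹_›) ‹_›
      · have h1 := hD J₀
        unfold excess
        rw [sum_add_single, sum_add_single, sum_add_single, if_pos hj,
          if_pos (mem_rowsOf.2 ⟨j, hj, hij⟩), if_pos (mem_rowsOf.2 ⟨j, hj, hkj⟩)]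
        omega
      · rw [eval_pochPoly_add_single (hle1 i), ← hp1, hz1]
        rfl
      · rw [hz1, cast_add_single (d + Pi.single i 1), add_assoc]
  obtain ⟨E, hE, hE'⟩ := hrec
  refine ⟨E, hE, fun s hs => ?_⟩
  have h1 := P.recurrence hA hD hs rfl J₀
  have h2 := hE' s hs
  simp only [Pi.add_apply] at h1 h2
  rw [← h1] at h2
  have h3 : ∑ i ∈ rowsOf A J₀, (s i + (d i : ℂ)) - ∑ j ∈ J₀, ((α j : ℂ) + 1) =
      eval s (hyperplanePoly A J₀ (excess A d α J₀)) := by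
    rw [eval_hyperplanePoly, excess, Nat.cast_sub (hD J₀)]
    push_cast
    simp only [Finset.sum_add_distrib, Finset.sum_const, nsmul_eq_mul, mul_one]
    ring
  have h4 : eval s (hyperplanePoly A J₀ (excess A d α J₀)) ≠ 0 :=
    eval_hyperplanePoly_ne_zero hA (mem_closedSets.1 hJ₀).1 _ fun i => by linarith [hs i]
  rw [h3] at h2
  exact mul_left_cancel₀ h4 (by linear_combination h2)

end

/-! ### The zeta function -/

section

open MvPolynomial

variable {n r : ℕ} {A : Matrix (Fin n) (Fin r) ℝ}

/-- The lattice `{1, 2, …}^r` without further shifts or weights. -/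
def ShiftFamily.lattice (r : ℕ) : ShiftFamily r where
  Ω := Unit
  ν := Measure.dirac ()
  shift := fun _ _ => 1
  measurable_shift := measurable_const
  bound := 1
  one_le_bound := le_rfl
  one_le_shift := fun _ _ => le_rfl
  shift_le := fun _ _ => le_rfl
  wt := fun _ => 1
  measurable_wt := measurable_const
  wtBound := 1
  abs_wt_le := fun _ => by simp

/-- The lattice point with positive coordinates that corresponds to `m ∈ ℕ^r`. -/
def succPoint (m : Fin r → ℕ) : Fin r → ℝ := fun j => (m j : ℝ) + 1

lemma one_le_succPoint (m : Fin r → ℕ) (j : Fin r) : 1 ≤ succPoint m j := by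
  simp [succPoint]

lemma zetaTerm_eq_kernel (hA : IsShintaniMatrix A) (s : Fin n → ℂ) (m : Fin r → ℕ) :
    zetaTerm A s (Equiv.piCongrRight (fun _ => Equiv.pnatEquivNat.symm) m) =
      kernel A s (succPoint m) := by
  have h : ∀ i, (∑ j, A i j *
      ((Equiv.piCongrRight (fun _ : Fin r => Equiv.pnatEquivNat.symm) m j : ℕ+) : ℝ)) =
      linForm A (succPoint m) i := fun i => by
    refine Finset.sum_congr rfl fun j _ => ?_
    simp [succPoint, Equiv.pnatEquivNat]
  simp only [zetaTerm, kernel, ← Finset.sum_neg_distrib, Complex.exp_sum]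
  refine Finset.prod_congr rfl fun i _ => ?_
  have hpos := hA.linForm_pos (one_le_succPoint m) i
  rw [h, Complex.cpow_def_of_ne_zero (Complex.ofReal_ne_zero.2 hpos.ne'),
    ← Complex.ofReal_log hpos.le]
  congr 1
  ring

lemma absConvergesAt_iff (hA : IsShintaniMatrix A) (s : Fin n → ℂ) :
    AbsConvergesAt A s ↔ Summable fun m : Fin r → ℕ => ‖kernel A s (succPoint m)‖ := by
  rw [AbsConvergesAt, ← (Equiv.piCongrRight (fun _ : Fin r => Equiv.pnatEquivNat.symm)).summable_iff]
  simp only [Function.comp_def, zetaTerm_eq_kernel hA]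

lemma zeta_eq_tsum (hA : IsShintaniMatrix A) (s : Fin n → ℂ) :
    zeta A s = ∑' m : Fin r → ℕ, kernel A s (succPoint m) := by
  rw [zeta, ← (Equiv.piCongrRight (fun _ : Fin r => Equiv.pnatEquivNat.symm)).tsum_eq]
  simp only [zetaTerm_eq_kernel hA]

lemma admissible_zero (A : Matrix (Fin n) (Fin r) ℝ) : Admissible A 0 0 := fun J => by simp

lemma absConvergesAt_of_lt_re (hA : IsShintaniMatrix A) {s : Fin n → ℂ}
    (hs : ∀ i, (r : ℝ) < (s i).re) : AbsConvergesAt A s := by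
  rw [absConvergesAt_iff hA]
  obtain ⟨C, p, hp, hC⟩ := hA.exists_majorant (B := 1) le_rfl (d := 0) (α := 0) (κ := 0) (N := 0)
    (σ := fun i => (s i).re) (by simp) (Or.inl hs)
  refine Summable.of_nonneg_of_le (fun _ => norm_nonneg _) (fun m => ?_)
    ((summable_prod_rpow r hp).mul_left C)
  rw [norm_kernel]
  simpa [weight] using hC m (succPoint m) (fun j => le_rfl) (fun j => by simp [succPoint])

lemma shintaniSum_lattice (hA : IsShintaniMatrix A) {s : Fin n → ℂ}
    (hs : ∀ i, (r : ℝ) < (s i).re) :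
    (ShiftFamily.lattice r).shintaniSum A 0 (s + fun i => (((0 : Fin n → ℕ) i : ℕ) : ℂ)) =
      zeta A s := by
  have h0 : (s + fun i => (((0 : Fin n → ℕ) i : ℕ) : ℂ)) = s := by
    ext i; simp
  have h1 : Integrable ((ShiftFamily.lattice r).integrand A 0 s) (ShiftFamily.lattice r).measure :=
    (ShiftFamily.lattice r).integrable_integrand_of_eq hA (admissible_zero A) hs h0.symm
  rw [h0, zeta_eq_tsum hA]
  refine (integral_prod _ h1).trans ?_
  have h2 : ∀ m : Fin r → ℕ, (∫ ω, (ShiftFamily.lattice r).integrand A 0 s (m, ω)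
      ∂(ShiftFamily.lattice r).ν) = kernel A s (succPoint m) := by
    intro m
    refine (integral_dirac (fun ω : Unit => (ShiftFamily.lattice r).integrand A 0 s (m, ω)) ()).trans ?_
    have h3 : (ShiftFamily.lattice r).integrand A 0 s (m, ()) =
      ((1 * weight 0 m : ℝ) : ℂ) * kernel A s (succPoint m) := rfl
    rw [h3]
    simp [weight]
  simp only [h2]
  have h3 : Integrable (fun m : Fin r → ℕ => kernel A s (succPoint m)) Measure.count := by
    rw [integrable_count_iff]
    exact (absConvergesAt_iff hA s).1 (absConvergesAt_of_lt_re hA hs)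
  rw [integral_countable h3]
  simp [Measure.real]

lemma isOpen_setOf_lt_re (v : Fin n → ℝ) : IsOpen {s : Fin n → ℂ | ∀ i, v i < (s i).re} := by
  simp only [Set.ofPred_forall]
  exact isOpen_iInter_of_finite fun i =>
    isOpen_lt continuous_const (Complex.continuous_re.comp (continuous_apply i))

lemma isPreconnected_setOf_lt_re (v : Fin n → ℝ) :
    IsPreconnected {s : Fin n → ℂ | ∀ i, v i < (s i).re} := by
  refine Convex.isPreconnected fun s hs t ht a b ha hb hab => fun i => ?_
  have h1 := hs i
  have h2 := ht i
  simp only [Pi.add_apply, Pi.smul_apply, Complex.add_re, Complex.smul_re, smul_eq_mul]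
  rcases ha.eq_or_lt with rfl | ha
  · have : b = 1 := by linarith
    subst this
    linarith
  · obtain rfl : b = 1 - a := by linarith
    linarith [mul_lt_mul_of_pos_left h1 ha, mul_le_mul_of_nonneg_left h2.le hb]

lemma norm_kernel_le {a : ℝ} (ha : 0 < a) {x : Fin r → ℝ} (hx : ∀ i, a ≤ linForm A x i)
    {z s : Fin n → ℂ} (h : ∀ i, (z i).re ≤ (s i).re) :
    ‖kernel A s x‖ ≤ Real.exp (-∑ i, ((s i).re - (z i).re) * Real.log a) * ‖kernel A z x‖ := by
  rw [norm_kernel, norm_kernel, ← Real.exp_add]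
  refine Real.exp_le_exp.2 ?_
  rw [← neg_add, neg_le_neg_iff, ← Finset.sum_add_distrib]
  refine Finset.sum_le_sum fun i _ => ?_
  have h1 := Real.log_le_log ha (hx i)
  nlinarith [h i]

lemma AbsConvergesAt.mono (hA : IsShintaniMatrix A) {z s : Fin n → ℂ} (hz : AbsConvergesAt A z)
    (h : ∀ i, (z i).re ≤ (s i).re) : AbsConvergesAt A s := by
  obtain ⟨a, ha, haA⟩ := hA.exists_pos_le
  rw [absConvergesAt_iff hA] at hz ⊢
  exact Summable.of_nonneg_of_le (fun _ => norm_nonneg _) (fun m => norm_kernel_le ha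
    (hA.const_le_linForm haA (one_le_succPoint m)) h) (hz.mul_left _)

/-- Beyond a point of absolute convergence, in the sense of real parts of all coordinates, the zeta
function is analytic. -/
lemma AbsConvergesAt.analyticAt_zeta (hA : IsShintaniMatrix A) {z s : Fin n → ℂ}
    (hz : AbsConvergesAt A z) (h : ∀ i, (z i).re < (s i).re) : AnalyticAt ℂ (zeta A) s := by
  obtain ⟨a, ha, haA⟩ := hA.exists_pos_le
  obtain ⟨ε, hε, hsε⟩ : ∃ ε : ℝ, 0 < ε ∧ ∀ i, (z i).re < (s i).re - ε := by
    have : ∀ i, ∀ᶠ ε in 𝓝[>] (0 : ℝ), (z i).re < (s i).re - ε := fun i => by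
      have hc : Tendsto (fun ε : ℝ => (s i).re - ε) (𝓝[>] 0) (𝓝 ((s i).re - 0)) :=
        (Continuous.tendsto (by fun_prop) 0).mono_left nhdsWithin_le_nhds
      rw [sub_zero] at hc
      exact hc.eventually_const_lt (h i)
    obtain ⟨ε, h1, h2⟩ := ((eventually_all.2 this).and self_mem_nhdsWithin).exists
    exact ⟨ε, h2, h1⟩
  have h1 : AnalyticAt ℂ (fun s : Fin n → ℂ => ∫ m : Fin r → ℕ, (1 : ℂ) *
      Complex.exp (-∑ i, s i * (Real.log (linForm A (succPoint m) i) : ℂ)) ∂Measure.count) s := by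
    refine analyticAt_integral_exp aestronglyMeasurable_const Measurable.of_discrete s
      (-Real.log a) ε hε (fun m i => ?_) ?_
    · rw [neg_neg]
      exact Real.log_le_log ha (hA.const_le_linForm haA (one_le_succPoint m) i)
    · rw [integrable_count_iff]
      have h2 := (absConvergesAt_iff hA _).1
        (hz.mono hA (s := s - fun _ => (ε : ℂ)) fun i => by simpa using (hsε i).le)
      refine h2.congr fun m => ?_
      rw [norm_kernel, norm_mul, norm_norm, norm_one, one_mul, Real.norm_of_nonneg (Real.exp_nonneg _)]
      simp
  refine h1.congr ?_
  filter_upwards [(isOpen_setOf_lt_re fun i => (z i).re).mem_nhds h] with t ht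
  have h2 : Integrable (fun m : Fin r → ℕ => kernel A t (succPoint m)) Measure.count := by
    rw [integrable_count_iff]
    exact (absConvergesAt_iff hA t).1 (hz.mono hA fun i => (ht i).le)
  have h3 := integral_countable h2
  simp only [kernel, one_mul] at h3 ⊢
  rw [h3, zeta_eq_tsum hA]
  simp [Measure.real, kernel]

/-- Radial continuity of the zeta function at points of absolute convergence. -/
lemma AbsConvergesAt.tendsto_zeta (hA : IsShintaniMatrix A) {z : Fin n → ℂ}
    (hz : AbsConvergesAt A z) :
    Tendsto (fun t : ℝ => zeta A (z + fun _ => (t : ℂ))) (𝓝[>] 0) (𝓝 (zeta A z)) := by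
  obtain ⟨a, ha, haA⟩ := hA.exists_pos_le
  simp only [zeta_eq_tsum hA]
  refine tendsto_tsum_of_dominated_convergence
    (bound := fun m => Real.exp (n * |Real.log a|) * ‖kernel A z (succPoint m)‖)
    (((absConvergesAt_iff hA z).1 hz).mul_left _) (fun m => ?_) ?_
  · have hc : Continuous fun t : ℝ => kernel A (z + fun _ => (t : ℂ)) (succPoint m) := by
      unfold kernel
      simp only [Pi.add_apply]
      fun_prop
    have := (hc.tendsto 0).mono_left (nhdsWithin_le_nhds (s := Set.Ioi 0))
    have h0 : (z + fun _ => ((0 : ℝ) : ℂ)) = z := by ext i; simp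
    rwa [h0] at this
  · filter_upwards [Ioo_mem_nhdsGT (zero_lt_one' ℝ)] with t ht m
    refine (norm_kernel_le (z := z) ha (hA.const_le_linForm haA (one_le_succPoint m))
      (fun i => by simpa using ht.1.le)).trans ?_
    refine mul_le_mul_of_nonneg_right (Real.exp_le_exp.2 ?_) (norm_nonneg _)
    simp only [Pi.add_apply, Complex.add_re, Complex.ofReal_re, add_sub_cancel_left,
      Finset.sum_const, Finset.card_univ, Fintype.card_fin, nsmul_eq_mul]
    rw [← mul_neg]
    refine mul_le_mul_of_nonneg_left ?_ (Nat.cast_nonneg _)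
    rw [← mul_neg]
    calc t * -Real.log a ≤ t * |Real.log a| :=
          mul_le_mul_of_nonneg_left (neg_le_abs _) ht.1.le
      _ ≤ |Real.log a| := mul_le_of_le_one_left (abs_nonneg _) ht.2.le

lemma isOpen_reGt (c : ℝ) : IsOpen (reGt n c) := isOpen_setOf_lt_re fun _ => c

lemma isPreconnected_reGt (c : ℝ) : IsPreconnected (reGt n c) :=
  isPreconnected_setOf_lt_re fun _ => c

/-- An identity `Q ζ_A = E` between analytic functions persists at every point of absolute
convergence, including points at which no neighbourhood consists of such points. -/
lemma AbsConvergesAt.mul_zeta_eq (hA : IsShintaniMatrix A) {z : Fin n → ℂ}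
    (hz : AbsConvergesAt A z) {N : ℕ} (hzN : z ∈ reGt n (-N)) {Q E : (Fin n → ℂ) → ℂ}
    (hQ : AnalyticOnNhd ℂ Q (reGt n (-N))) (hE : AnalyticOnNhd ℂ E (reGt n (-N)))
    (h : ∀ s ∈ reGt n (r + 1), Q s * zeta A s = E s) : Q z * zeta A z = E z := by
  set U : Set (Fin n → ℂ) := {s | ∀ i, (z i).re < (s i).re} with hU
  have hUN : U ⊆ reGt n (-N) := fun s hs i => (hzN i).trans (hs i)
  have h1 : AnalyticOnNhd ℂ (fun s => Q s * zeta A s) U := fun s hs =>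
    (hQ s (hUN hs)).mul (hz.analyticAt_zeta hA hs)
  have h2 : AnalyticOnNhd ℂ E U := hE.mono hUN
  let p₀ : Fin n → ℂ := fun i => ((|(z i).re| + (r + 2) : ℝ) : ℂ)
  have hp₀U : p₀ ∈ U := fun i => by
    have := le_abs_self (z i).re
    have h0 : (0 : ℝ) ≤ r := Nat.cast_nonneg r
    simp only [p₀, Complex.ofReal_re]
    linarith
  have hp₀ : p₀ ∈ reGt n (r + 1) := fun i => by
    have := abs_nonneg (z i).re
    simp only [p₀, Complex.ofReal_re]
    linarith
  have h3 := h1.eqOn_of_preconnected_of_eventuallyEq h2 (isPreconnected_setOf_lt_re _) hp₀U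
    (((isOpen_reGt _).eventually_mem hp₀).mono fun s hs => h s hs)
  have hray : Tendsto (fun t : ℝ => z + fun _ => (t : ℂ)) (𝓝[>] 0) (𝓝 z) := by
    have hc : Continuous fun t : ℝ => (z + fun _ => (t : ℂ) : Fin n → ℂ) := by fun_prop
    have := (hc.tendsto 0).mono_left (nhdsWithin_le_nhds (s := Set.Ioi 0))
    have h0 : (z + fun _ => ((0 : ℝ) : ℂ)) = z := by ext i; simp
    rwa [h0] at this
  have h4 := ((hQ z hzN).continuousAt.tendsto.comp hray).mul (hz.tendsto_zeta hA)
  have h5 := (hE z hzN).continuousAt.tendsto.comp hray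
  refine tendsto_nhds_unique h4 (h5.congr' ?_)
  filter_upwards [self_mem_nhdsWithin] with t ht
  refine (h3 (x := z + fun _ => (t : ℂ)) fun i => ?_).symm
  simpa using ht

/-- The denominator of the zeta function itself, in the region where all real parts exceed `-N`. -/
def zetaDenom (A : Matrix (Fin n) (Fin r) ℝ) (N : ℕ) : MvPolynomial (Fin n) ℂ :=
  denom A ((n * N + 2) * r) 0 0

lemma analyticOnNhd_eval (Q : MvPolynomial (Fin n) ℂ) (U : Set (Fin n → ℂ)) :
    AnalyticOnNhd ℂ (fun s => eval s Q) U :=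
  (AnalyticOnNhd.eval_mvPolynomial Q).mono (Set.subset_univ U)

lemma exists_numerator (hA : IsShintaniMatrix A) (N : ℕ) :
    ∃ E : (Fin n → ℂ) → ℂ, AnalyticOnNhd ℂ E (reGt n (-N)) ∧
      ∀ s ∈ reGt n (r + 1), eval s (zetaDenom A N) * zeta A s = E s := by
  obtain ⟨E, hE, hE'⟩ := hasContinuation hA N (ShiftFamily.lattice r) (admissible_zero A)
  refine ⟨E, hE, fun s hs => ?_⟩
  rw [← hE' s hs, shintaniSum_lattice hA fun i => by linarith [hs i]]
  rfl

/-- A point far in the region of absolute convergence. -/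
lemma const_mem_reGt : (fun _ => ((r + 2 : ℝ) : ℂ) : Fin n → ℂ) ∈ reGt n (r + 1) := fun i => by
  simp only [Complex.ofReal_re]
  linarith

lemma reGt_subset (N : ℕ) : reGt n (r + 1) ⊆ reGt n (-N) := fun s hs i => by
  have h1 := hs i
  have h2 : (0 : ℝ) ≤ r := Nat.cast_nonneg r
  have h3 : (0 : ℝ) ≤ N := Nat.cast_nonneg N
  linarith

lemma not_eventually_zetaDenom_eq_zero (hA : IsShintaniMatrix A) (N : ℕ) (p : Fin n → ℂ) :
    ¬ ∀ᶠ z in 𝓝 p, eval z (zetaDenom A N) = 0 := by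
  intro h
  have h1 := (analyticOnNhd_eval (zetaDenom A N) Set.univ).eqOn_zero_of_preconnected_of_eventuallyEq_zero
    isPreconnected_univ (Set.mem_univ p) h
  have h2 : eval (fun _ => ((r + 2 : ℝ) : ℂ)) (zetaDenom A N) = 0 := h1 (Set.mem_univ _)
  rw [zetaDenom, denom, map_prod, Finset.prod_eq_zero_iff] at h2
  obtain ⟨J, hJ, h3⟩ := h2
  rw [map_prod, Finset.prod_eq_zero_iff] at h3
  obtain ⟨l, -, h4⟩ := h3
  exact eval_hyperplanePoly_ne_zero hA (mem_closedSets.1 hJ).1 l (fun i => by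
    simp only [Complex.ofReal_re]; linarith) h4

lemma exists_mem_reGt_neg (p : Fin n → ℂ) : ∃ N : ℕ, p ∈ reGt n (-N) := by
  obtain ⟨N, hN⟩ := exists_nat_gt (∑ i, |(p i).re|)
  refine ⟨N, fun i => ?_⟩
  have h1 : |(p i).re| ≤ ∑ i, |(p i).re| :=
    Finset.single_le_sum (f := fun i => |(p i).re|) (fun _ _ => abs_nonneg _) (Finset.mem_univ i)
  have := neg_abs_le (p i).re
  linarith

/-- The local quotients glue to a meromorphic extension. -/
theorem exists_isMeromorphicExtension (hA : IsShintaniMatrix A) :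
    ∃ F : (Fin n → ℂ) → ℂ, IsMeromorphicExtension A F := by
  classical
  choose E hE hE' using exists_numerator hA
  have hcompat : ∀ N N' : ℕ, N ≤ N' → ∀ s ∈ reGt n (-N),
      eval s (zetaDenom A N') * E N s = eval s (zetaDenom A N) * E N' s := by
    intro N N' hN s hs
    have hsub : reGt n (-N) ⊆ reGt n (-N') := fun t ht i => by
      have h1 := ht i
      have h2 : (N : ℝ) ≤ N' := Nat.cast_le.2 hN
      linarith
    refine ((analyticOnNhd_eval _ _).mul (hE N)).eqOn_of_preconnected_of_eventuallyEq
      ((analyticOnNhd_eval _ _).mul ((hE N').mono hsub)) (isPreconnected_reGt _)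
      (reGt_subset N (const_mem_reGt (r := r))) ?_ hs
    filter_upwards [(isOpen_reGt _).mem_nhds (const_mem_reGt (n := n) (r := r))] with t ht
    change eval t (zetaDenom A N') * E N t = eval t (zetaDenom A N) * E N' t
    rw [← hE' N t ht, ← hE' N' t ht]
    ring
  -- On the zero set of the denominators the values are forced only at points of absolute convergence.
  let F : (Fin n → ℂ) → ℂ := fun s =>
    if AbsConvergesAt A s then zeta A s else
    if h : ∃ N : ℕ, s ∈ reGt n (-N) ∧ eval s (zetaDenom A N) ≠ 0 then
      E h.choose s / eval s (zetaDenom A h.choose) else 0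
  have hF : ∀ (N : ℕ) (s : Fin n → ℂ), s ∈ reGt n (-N) → eval s (zetaDenom A N) ≠ 0 →
      F s = E N s / eval s (zetaDenom A N) := by
    intro N s hs hne
    by_cases hc : AbsConvergesAt A s
    · simp only [F, if_pos hc]
      rw [eq_div_iff hne, mul_comm]
      exact hc.mul_zeta_eq hA hs (analyticOnNhd_eval _ _) (hE N) (hE' N)
    · have hex : ∃ N : ℕ, s ∈ reGt n (-N) ∧ eval s (zetaDenom A N) ≠ 0 := ⟨N, hs, hne⟩
      simp only [F, if_neg hc, dif_pos hex]
      obtain ⟨h1, h2⟩ := hex.choose_spec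
      rw [div_eq_div_iff h2 hne]
      rcases le_total N hex.choose with h | h
      · linear_combination -hcompat _ _ h s hs
      · linear_combination hcompat _ _ h s h1
  refine ⟨F, fun p => ?_, fun s hs => by simp only [F, if_pos hs]⟩
  obtain ⟨N, hN⟩ := exists_mem_reGt_neg p
  refine ⟨E N, fun s => eval s (zetaDenom A N), hE N p hN, analyticOnNhd_eval _ _ p hN,
    not_eventually_zetaDenom_eq_zero hA N p, ?_⟩
  filter_upwards [(isOpen_reGt _).mem_nhds hN] with z hz hne
  exact hF N z hz hne

lemma mu_eq_ite (A : Matrix (Fin n) (Fin r) ℝ) (J : Finset (Fin r)) (i : Fin n) :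
    mu A J i = if i ∈ rowsOf A J then 1 else 0 := by
  classical
  rw [mu, Set.indicator_apply]
  congr 1
  simp [mem_rowsOf]

/-- Where the denominator of the zeta function vanishes, one of the admitted hyperplanes passes. -/
lemma exists_hyperplane_of_zetaDenom_eq_zero {N : ℕ} {s : Fin n → ℂ}
    (h : eval s (zetaDenom A N) = 0) : ∃ (J : Finset (Fin r)) (l : ℕ), J.Nonempty ∧
      ((∃ i, mu A J = Pi.single i 1) → l ∈ Finset.range J.card) ∧ s ∈ hyperplane A J l := by
  rw [zetaDenom, denom, map_prod, Finset.prod_eq_zero_iff] at h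
  obtain ⟨J, hJ, h1⟩ := h
  rw [map_prod, Finset.prod_eq_zero_iff] at h1
  obtain ⟨l, hl, h2⟩ := h1
  refine ⟨J, l, (mem_closedSets.1 hJ).1, ?_, ?_⟩
  · rintro ⟨i, hi⟩
    have hrow : rowsOf A J = {i} := by
      ext k
      have h3 := congrFun hi k
      rw [mu_eq_ite, Pi.single_apply] at h3
      rw [Finset.mem_singleton]
      split_ifs at h3 with h4 h5 h5
      · exact ⟨fun _ => h5, fun _ => h4⟩
      · exact ⟨fun h => absurd h h4, fun h => absurd h h5⟩
    have h3 := (Finset.mem_Ico.1 hl).2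
    rw [upper, hrow] at h3
    simpa using h3
  · rw [eval_hyperplanePoly] at h2
    have h3 : ∑ i, (mu A J i : ℂ) * s i = ∑ i ∈ rowsOf A J, s i := by
      simp [mu_eq_ite, Finset.sum_ite_mem]
    simp only [hyperplane, Set.mem_ofPred_eq]
    rw [h3]
    linear_combination h2

/-- Every meromorphic extension is holomorphic off the zeros of the denominators. -/
lemma notMem_singularLocus (hA : IsShintaniMatrix A) {F : (Fin n → ℂ) → ℂ}
    (hF : IsMeromorphicExtension A F) {N : ℕ} {s : Fin n → ℂ} (hs : s ∈ reGt n (-N))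
    (hne : eval s (zetaDenom A N) ≠ 0) : s ∉ singularLocus F := by
  obtain ⟨E, hE, hE'⟩ := exists_numerator hA N
  have hQ := analyticOnNhd_eval (zetaDenom A N) (reGt n (-N))
  obtain ⟨h, hh, hh0, hhF⟩ := hF.1.generic_eq (isOpen_reGt _) (isPreconnected_reGt _) hQ hE
    (reGt_subset N (const_mem_reGt (r := r))) (by
      filter_upwards [(isOpen_reGt _).mem_nhds (const_mem_reGt (n := n) (r := r))] with t ht
      rw [hF.2 t (absConvergesAt_of_lt_re hA fun i => by linarith [ht i]), hE' t ht]) hs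
  simp only [singularLocus, Set.mem_ofPred_eq, not_not]
  refine ⟨fun z => E z / eval z (zetaDenom A N), (hE s hs).div (hQ s hs) hne, h, hh, hh0, ?_⟩
  filter_upwards [hhF, (hQ s hs).continuousAt.eventually_ne hne] with z hz hz' hhz
  rw [eq_div_iff hz', mul_comm]
  exact hz hhz

end

end Shintani

end

theorem mainTheorem2 {n r : ℕ} (A : Matrix (Fin n) (Fin r) ℝ) (hA : Shintani.IsShintaniMatrix A) :
    (∀ s : Fin n → ℂ, (∀ i, (r : ℝ) < (s i).re) → Shintani.AbsConvergesAt A s) ∧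
    (∃ F : (Fin n → ℂ) → ℂ, Shintani.IsMeromorphicExtension A F) ∧
    ∀ F : (Fin n → ℂ) → ℂ, Shintani.IsMeromorphicExtension A F →
      ∀ s ∈ Shintani.singularLocus F,
        ∃ (J : Finset (Fin r)) (l : ℕ), J.Nonempty ∧
          ((∃ i, Shintani.mu A J = Pi.single i 1) → l ∈ Finset.range J.card) ∧
          s ∈ Shintani.hyperplane A J l := by
  refine ⟨fun s hs => Shintani.absConvergesAt_of_lt_re hA hs,
    Shintani.exists_isMeromorphicExtension hA, fun F hF s hs => ?_⟩
  obtain ⟨N, hN⟩ := Shintani.exists_mem_reGt_neg s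
  by_contra hcon
  exact Shintani.notMem_singularLocus hA hF hN
    (fun h => hcon (Shintani.exists_hyperplane_of_zetaDenom_eq_zero h)) hs
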